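/- **Theorem 4 (Analytic trace formula).** Let $p$ be a prime, $q=p^a$ with $a\ge 1$, and let $f_0,f_1,f_2,\dots\in\mathbb{F}_q[x]$ be polynomials of bounded degree with $\deg f_0>0$. Write $f_i=\sum_u a_{iu}x^u$. For $k\ge1$ let $\mathbb{Z}_{q^k}=W(\mathbb{F}_{q^k})$ be the ring of integers of the unramified extension $\mathbb{Q}_{q^k}$ of $\mathbb{Q}_p$ of degree $ak$, and $\mu_{q^k-1}\subset\mathbb{Z}_{q^k}$ the group of $(q^k-1)$-th roots of unity. Let $\hat c$ denote the Teichmüller lift of $c$, and put $\hat f_i(x)=\sum_u\widehat{a_{iu}}\,x^u$, $\hat f(x)=\sum_{i\ge0}p^i\hat f_i(x)$, $$S_f(T,k)=\sum_{x\in\mu_{q^k-1}}(1+T)^{\mathrm{Tr}_{\mathbb{Q}_{q^k}/\mathbb{Q}_p}(\hat f(x))}\in\mathbb{Z}_p[[T]],\qquad C_f(T,s)=\exp\Bigl(-\sum_{k\ge1}\frac{S_f(T,k)}{q^k-1}\,\frac{s^k}{k}\Bigr)\in\mathbb{Q}_p[[T]][[s]].$$ Let $E(X)=\exp\bigl(\sum_{i\ge0}X^{p^i}/p^i\bigr)\in\mathbb{Z}_p[[X]]$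 be the Artin–Hasse series, let $\pi_i\in T\,\mathbb{Z}_p[[T]]$ be the series with $E(\pi_i)=(1+T)^{p^i}$, and let $$E_f(x)=\prod_{i\ge0}\ \prod_{u=0}^{\deg f_i}E(\pi_i\,\widehat{a_{iu}}\,x^u)\in\mathbb{Z}_q[[T]][[x]].$$ Let $\sigma$ be the Frobenius automorphism of $\mathbb{Z}_q$, acting on the coefficients of $\mathbb{Z}_q[[T]][[x]]$ (with $\sigma(T)=T$, $\sigma(x)=x$), let $\varphi_p(\sum_u b_ux^u)=\sum_u b_{pu}x^u$, and let $\varphi=\sigma^{-1}\circ\varphi_p\circ E_f(x)$, where $E_f(x)$ stands for multiplication by $E_f(x)$. Let $M$ be the matrix of $\varphi$ with respect to $1,x,x^2,\dots$ and let $M^a$ denote the matrix of the ($\mathbb{Z}_q[[T]]$-linear) iterate $\varphi^a$ with respect to $1,x,x^2,\dots$; as $\varphi$ is $\sigma^{-1}$-semilinear, this is the product $M\cdot\sigma^{-1}(M)\cdots\sigma^{-(a-1)}(M)$. Then the product defining $E_f(x)$ converges (coefficientwise $p$-adically); the determinant $$\det(I-sM^a)=\sum_{n\ge0}(-1)^n\Bigl(\sum_{S\subset\mathbb{N},\,|S|=n}\det\bigl((M^a)_{u,v}\bigr)_{u,v\in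 S}\Bigr)s^n$$ exists, i.e. all the inner sums converge $T$-adically; $C_f(T,s)$ has coefficients in $\mathbb{Z}_p[[T]]$; and $$C_f(T,s)=\det(I-sM^a)\quad\text{in }\mathbb{Z}_q[[T]][[s]].$$ Moreover $C_f(T,s)=\sum_n b_n(T)s^n$ is $T$-adically analytic (entire) in $s$: $\operatorname{ord}_T(b_n)/n\to\infty$ as $n\to\infty$. -/

import Mathlib

open PowerSeries

namespace TAdicWitt
section ArtinHasse
variable (p : ℕ) [Fact p.Prime]

/-- A `p`-adic number of norm at most one, as a `p`-adic integer. -/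
def padicIntMk (x : ℚ_[p]) (hx : ‖x‖ ≤ 1) : ℤ_[p] := ⟨x, hx⟩

/-- The series `∑_{i ≥ 0} X ^ (p ^ i) / p ^ i`. -/
noncomputable def ahLog : ℚ_[p]⟦X⟧ :=
  open scoped Classical in
  PowerSeries.mk fun n => if ∃ i : ℕ, n = p ^ i then (n : ℚ_[p])⁻¹ else 0

/-- The Artin-Hasse series `exp (∑_{i ≥ 0} X ^ (p ^ i) / p ^ i)` over `ℚ_p`. -/
noncomputable def artinHasseQ : ℚ_[p]⟦X⟧ :=
  (PowerSeries.exp ℚ_[p]).subst (ahLog p)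

theorem ahLog_zero : constantCoeff (ahLog p) = 0 := by
  have hp := (Fact.out : p.Prime)
  rw [← coeff_zero_eq_constantCoeff_apply, ahLog, coeff_mk, if_neg]
  rintro ⟨i, hi⟩
  exact (pow_pos hp.pos i).ne hi

theorem ode_unique {F G H : ℚ_[p]⟦X⟧} (hF : derivative ℚ_[p] F = H * F)
    (hG : derivative ℚ_[p] G = H * G) (h0 : constantCoeff F = constantCoeff G) : F = G := by
  ext n
  induction n using Nat.strong_induction_on with
  | _ n ih =>
    cases n with
    | zero => simpa using h0
    | succ n =>
      have e1 := congrArg (coeff n) hF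
      have e2 := congrArg (coeff n) hG
      rw [coeff_derivative, coeff_mul] at e1 e2
      have : ∑ x ∈ Finset.HasAntidiagonal.antidiagonal n, coeff x.1 H * coeff x.2 F
          = ∑ x ∈ Finset.HasAntidiagonal.antidiagonal n, coeff x.1 H * coeff x.2 G := by
        refine Finset.sum_congr rfl fun x hx => ?_
        rw [ih x.2 (by have := Finset.HasAntidiagonal.mem_antidiagonal.1 hx; omega)]
      rw [this, ← e2] at e1
      exact mul_right_cancel₀ (by exact_mod_cast n.succ_ne_zero) e1

theorem artinHasseQ_zero : constantCoeff (artinHasseQ p) = 1 := by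
  rw [artinHasseQ, ← coeff_zero_eq_constantCoeff_apply,
    coeff_subst' (HasSubst.of_constantCoeff_zero' (ahLog_zero p)),
    finsum_eq_single _ 0]
  · simp
  · intro n hn
    simp [ahLog_zero, hn]

theorem derivative_artinHasseQ :
    derivative ℚ_[p] (artinHasseQ p) = derivative ℚ_[p] (ahLog p) * artinHasseQ p := by
  rw [artinHasseQ, derivative_subst (HasSubst.of_constantCoeff_zero' (ahLog_zero p)),
    derivative_exp, mul_comm]

theorem ahLog_expand : (p : ℚ_[p]⟦X⟧) * ahLog p =
    expand p (Fact.out : p.Prime).ne_zero (ahLog p) + (p : ℚ_[p]⟦X⟧) * X := by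
  have hp := (Fact.out : p.Prime)
  have hp0 : (p : ℚ_[p]) ≠ 0 := by exact_mod_cast hp.ne_zero
  ext n
  have hc : (p : ℚ_[p]⟦X⟧) = C (p : ℚ_[p]) := by simp
  rw [map_add, hc, coeff_C_mul, coeff_C_mul, coeff_expand, coeff_X, ahLog]
  simp only [coeff_mk]
  by_cases h1 : n = 1
  · subst h1
    rw [if_pos ⟨0, by simp⟩, if_neg (by simpa using hp.ne_one)]
    simp
  · by_cases h : ∃ i, n = p ^ i
    · obtain ⟨i, rfl⟩ := h
      cases i with
      | zero => simp at h1
      | succ i =>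
        rw [if_pos ⟨i + 1, rfl⟩, if_pos (dvd_pow_self p i.succ_ne_zero), if_neg h1]
        have : p ^ (i + 1) / p = p ^ i := by
          rw [pow_succ, Nat.mul_div_cancel _ hp.pos]
        rw [this, if_pos ⟨i, rfl⟩]
        push_cast
        field_simp
        ring
    · rw [if_neg h, if_neg h1]
      split_ifs with h2 h3
      · obtain ⟨i, hi⟩ := h3
        exact (h ⟨i + 1, by rw [pow_succ, ← hi, Nat.div_mul_cancel h2]⟩).elim
      · simp
      · simp

theorem artinHasseQ_pow : artinHasseQ p ^ p =
    expand p (Fact.out : p.Prime).ne_zero (artinHasseQ p) *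
      rescale (p : ℚ_[p]) (PowerSeries.exp ℚ_[p]) := by
  have hp := (Fact.out : p.Prime)
  have hs : HasSubst (X ^ p : ℚ_[p]⟦X⟧) := HasSubst.X_pow hp.ne_zero
  have hs' : HasSubst ((p : ℚ_[p]) • X : ℚ_[p]⟦X⟧) := HasSubst.smul_X' _
  have hl := congrArg (derivative ℚ_[p]) (ahLog_expand p)
  have hc : (p : ℚ_[p]⟦X⟧) = C (p : ℚ_[p]) := by simp
  refine ode_unique p (H := (p : ℚ_[p]⟦X⟧) * derivative ℚ_[p] (ahLog p)) ?_ ?_ ?_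
  · rw [Derivation.leibniz_pow, derivative_artinHasseQ]
    rw [← mul_pow_sub_one hp.ne_zero (artinHasseQ p)]
    simp only [nsmul_eq_mul, smul_eq_mul]
    ring
  · have h1 : (p : ℚ_[p]⟦X⟧) * derivative ℚ_[p] (ahLog p) =
        derivative ℚ_[p] (expand p hp.ne_zero (ahLog p)) + (p : ℚ_[p]⟦X⟧) := by
      simpa [Derivation.leibniz] using hl
    rw [h1, Derivation.leibniz, rescale_eq_subst, derivative_subst hs', derivative_exp,
      expand_apply, expand_apply, derivative_subst hs, derivative_subst hs,
      derivative_artinHasseQ, subst_mul hs]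
    have h2 : derivative ℚ_[p] ((p : ℚ_[p]) • X : ℚ_[p]⟦X⟧) = (p : ℚ_[p]⟦X⟧) := by
      rw [Derivation.map_smul, derivative_X, smul_eq_C_mul, mul_one, hc]
    rw [h2]
    simp only [smul_eq_mul]
    ring
  · rw [map_mul, map_pow, constantCoeff_expand, artinHasseQ_zero,
      ← coeff_zero_eq_constantCoeff_apply, coeff_rescale]
    simp

theorem norm_pow_div_factorial {j : ℕ} (hj : j ≠ 0) :
    ‖(p : ℚ_[p]) ^ j * (1 / (j.factorial : ℚ_[p]))‖ ≤ ‖(p : ℚ_[p])‖ := by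
  have hp := (Fact.out : p.Prime)
  have hv : padicValNat p j.factorial < j := padicValNat_factorial_lt_of_ne_zero p hj
  have hn : ‖(j.factorial : ℚ_[p])‖ = (p : ℝ) ^ (-(padicValNat p j.factorial : ℤ)) := by
    rw [Padic.norm_eq_zpow_neg_valuation (by exact_mod_cast j.factorial_ne_zero)]
    simp
  have hp1 : (1 : ℝ) < p := by exact_mod_cast hp.one_lt
  rw [norm_mul, norm_div, hn, norm_pow, Padic.norm_p, norm_one, one_div, ← zpow_neg, neg_neg,
    ← zpow_natCast, inv_zpow', ← zpow_add₀ (by positivity), ← zpow_neg_one]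
  exact zpow_le_zpow_right₀ hp1.le (by omega)

/-- The Artin-Hasse series has `p`-integral coefficients. -/
theorem norm_coeff_artinHasseQ_le (n : ℕ) : ‖coeff n (artinHasseQ p)‖ ≤ 1 := by
  have hp := (Fact.out : p.Prime)
  induction n using Nat.strong_induction_on with
  | _ n ih =>
    rcases Nat.eq_zero_or_pos n with rfl | hn
    · simp [artinHasseQ_zero]
    set P : ℤ_[p]⟦X⟧ := PowerSeries.mk fun m =>
      if h : m < n then padicIntMk p (coeff m (artinHasseQ p)) (ih m h) else 0 with hP
    set ι : ℤ_[p] →+* ℚ_[p] := PadicInt.Coe.ringHom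
    have hPc : ∀ m, m < n → ι (coeff m P) = coeff m (artinHasseQ p) := by
      intro m hm
      rw [hP, coeff_mk, dif_pos hm]
      rfl
    have hι : ∀ z : ℤ_[p], ‖ι z‖ ≤ 1 := fun z => z.2
    obtain ⟨R, hR⟩ : X ^ n ∣ artinHasseQ p - PowerSeries.map ι P := by
      rw [X_pow_dvd_iff]
      intro m hm
      simp [hPc m hm]
    have hR0 : constantCoeff R = coeff n (artinHasseQ p) := by
      have := congrArg (coeff n) hR
      rw [coeff_X_pow_mul', if_pos le_rfl] at this
      simpa [hP] using this.symm
    have hE : artinHasseQ p = PowerSeries.map ι P + X ^ n * R := by rw [← hR]; ring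
    have hpow := artinHasseQ_pow p
    obtain ⟨k, hk⟩ := Polynomial.powAddExpansion (PowerSeries.map ι P) (X ^ n * R) p
    -- the coefficient of the left-hand side
    have hL : coeff n (artinHasseQ p ^ p) =
        ι (coeff n (P ^ p)) + (p : ℚ_[p]) * coeff n (artinHasseQ p) := by
      rw [hE, hk]
      have e1 : (p : ℚ_[p]⟦X⟧) * (PowerSeries.map ι P) ^ (p - 1) * (X ^ n * R) =
          X ^ n * (C (p : ℚ_[p]) * ((PowerSeries.map ι P) ^ (p - 1) * R)) := by
        simp; ring
      have e2 : k * (X ^ n * R) ^ 2 = X ^ (n + 1) * (X ^ (n - 1) * (k * R ^ 2)) := by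
        rw [← mul_assoc (X ^ (n + 1)), ← pow_add, show n + 1 + (n - 1) = n * 2 by omega]
        ring
      rw [e1, e2, map_add, map_add, ← map_pow, coeff_map, coeff_X_pow_mul', if_pos le_rfl,
        coeff_X_pow_mul', if_neg (by omega), ← hE]
      have hP0 : ι (constantCoeff P) = 1 := by
        rw [← coeff_zero_eq_constantCoeff_apply, hPc 0 hn]
        simp [artinHasseQ_zero]
      have hP0' : constantCoeff (PowerSeries.map ι P) = 1 := by
        rw [← coeff_zero_eq_constantCoeff_apply, coeff_map]
        simpa using hP0
      simp only [Nat.sub_self, coeff_zero_eq_constantCoeff_apply, map_mul, map_pow, hP0', hR0]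
      simp
    have hexp : ∀ i, i ≤ n → coeff i (expand p hp.ne_zero (artinHasseQ p)) =
        ι (coeff i (expand p hp.ne_zero P)) := by
      intro i hi
      rw [coeff_expand, coeff_expand]
      split_ifs with h
      · rw [hPc]
        rcases Nat.eq_zero_or_pos i with rfl | hi0
        · simpa using hn
        · exact (Nat.div_lt_self hi0 hp.one_lt).trans_le hi
      · simp
    -- the Frobenius congruence
    have hfrob : ‖ι (coeff n (expand p hp.ne_zero P) - coeff n (P ^ p))‖ ≤ ‖(p : ℚ_[p])‖ := by
      have hz : PadicInt.toZMod (coeff n (expand p hp.ne_zero P) - coeff n (P ^ p)) = 0 := by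
        rw [map_sub, ← coeff_map, ← coeff_map, map_expand, map_pow, sub_eq_zero]
        have := MvPowerSeries.map_frobenius_expand (R := ZMod p) (σ := Unit) p hp.ne_zero
          (f := PowerSeries.map PadicInt.toZMod P)
        rw [ZMod.frobenius_zmod] at this
        rw [← this]
        rfl
      have hm := (PadicInt.ker_toZMod (p := p)) ▸ (RingHom.mem_ker.2 hz)
      rw [PadicInt.maximalIdeal_eq_span_p, Ideal.mem_span_singleton] at hm
      obtain ⟨c, hc⟩ := hm
      rw [hc, map_mul, map_natCast, norm_mul]
      exact mul_le_of_le_one_right (norm_nonneg _) (hι c)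
    have hRHS : ‖coeff n (artinHasseQ p ^ p) - ι (coeff n (expand p hp.ne_zero P))‖
        ≤ ‖(p : ℚ_[p])‖ := by
      rw [hpow, coeff_mul, ← Finset.add_sum_erase _ _
        (Finset.HasAntidiagonal.mem_antidiagonal.2 (add_zero n) : ((n, 0) : ℕ × ℕ) ∈ _)]
      have h0 : coeff 0 (rescale (p : ℚ_[p]) (PowerSeries.exp ℚ_[p])) = 1 := by
        simp [coeff_rescale]
      rw [h0, mul_one, hexp n le_rfl, add_sub_cancel_left]
      refine IsUltrametricDist.norm_sum_le_of_forall_le_of_nonneg (norm_nonneg _) fun x hx => ?_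
      obtain ⟨hx1, hx2⟩ := Finset.mem_erase.1 hx
      have hx3 := Finset.HasAntidiagonal.mem_antidiagonal.1 hx2
      have hx4 : x.2 ≠ 0 := fun h => hx1 (Prod.ext (by simp; omega) h)
      rw [hexp x.1 (by omega), norm_mul, coeff_rescale, coeff_exp]
      refine (mul_le_of_le_one_left (norm_nonneg _) (hι _)).trans ?_
      simpa using norm_pow_div_factorial p hx4
    have : ‖(p : ℚ_[p]) * coeff n (artinHasseQ p)‖ ≤ ‖(p : ℚ_[p])‖ := by
      have e : (p : ℚ_[p]) * coeff n (artinHasseQ p) =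
        (coeff n (artinHasseQ p ^ p) - ι (coeff n (expand p hp.ne_zero P))) +
          ι (coeff n (expand p hp.ne_zero P) - coeff n (P ^ p)) := by
        rw [hL, map_sub]; ring
      rw [e]
      exact (Padic.nonarchimedean _ _).trans (max_le hRHS hfrob)
    rw [norm_mul] at this
    have hpp : 0 < ‖(p : ℚ_[p])‖ := norm_pos_iff.2 (by exact_mod_cast hp.ne_zero)
    exact (mul_le_iff_le_one_right hpp).1 this

/-- The Artin-Hasse series `E(X)` as an element of `ℤ_p⟦X⟧`. -/
noncomputable def artinHasse : ℤ_[p]⟦X⟧ :=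
  PowerSeries.mk fun n =>
    padicIntMk p (coeff n (artinHasseQ p)) (norm_coeff_artinHasseQ_le p n)

theorem isUnit_coeff_one_artinHasse : IsUnit (coeff 1 (artinHasse p - 1)) := by
  have h : coeff 1 (artinHasseQ p) = 1 := by
    have h1 := congrArg (coeff 0) (derivative_artinHasseQ p)
    rw [coeff_derivative, coeff_mul] at h1
    simp only [zero_add, Finset.HasAntidiagonal.antidiagonal_zero, Finset.sum_singleton] at h1
    rw [coeff_derivative, ahLog, coeff_mk, if_pos ⟨0, by simp⟩] at h1
    simpa [artinHasseQ_zero] using h1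
  have h2 : coeff 1 (artinHasse p) = 1 := by
    rw [artinHasse, coeff_mk]
    exact Subtype.ext h
  rw [map_sub, h2, coeff_one, if_neg one_ne_zero, sub_zero]
  exact isUnit_one

/-- `π_i`, the power series in `T` without constant term with `E(π_i) = (1 + T) ^ (p ^ i)`:
the compositional inverse of `E(X) - 1`, evaluated at `(1 + T) ^ (p ^ i) - 1`. -/
noncomputable def piSeries (i : ℕ) : ℤ_[p]⟦X⟧ :=
  (substInvOfIsUnit (artinHasse p - 1) (isUnit_coeff_one_artinHasse p)).subst
    ((1 + X) ^ p ^ i - 1 : ℤ_[p]⟦X⟧)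

end ArtinHasse

section WittRing

variable (p : ℕ) [Fact p.Prime] {K : Type*} [Field K] [CharP K p]

/-- The canonical map `ℤ_p = W(𝔽_p) → W(K)`. -/
noncomputable def padicIntToWitt : ℤ_[p] →+* WittVector p K :=
  (WittVector.map (ZMod.castHom (dvd_refl p) K)).comp
    ((WittVector.equiv p).symm : ℤ_[p] →+* WittVector p (ZMod p))

/-- The trace `W(K) → ℤ_p`, for `K` a finite field: the trace of the finite free
`ℤ_p`-algebra `W(K)`. -/
noncomputable def wittTrace (y : WittVector p K) : ℤ_[p] :=
  letI : Algebra ℤ_[p] (WittVector p K) := (padicIntToWitt p).toAlgebra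
  Algebra.trace ℤ_[p] (WittVector p K) y

/-- The `p`-adic topology of `W(K)`. -/
@[reducible]
noncomputable def wittTopology (p : ℕ) [Fact p.Prime] (K : Type*) [Field K] :
    TopologicalSpace (WittVector p K) :=
  (Ideal.span {(p : WittVector p K)}).adicTopology

/-- The coefficientwise lift of a polynomial by Teichmüller representatives. -/
noncomputable def teichPoly (h : Polynomial K) : Polynomial (WittVector p K) :=
  h.sum fun u c => Polynomial.monomial u (WittVector.teichmuller p c)

/-- The value `∑_i p ^ i * f̂_i(x)` at a point `x` of `W(L)`, for an extension `L` of `K`. -/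
noncomputable def fHat {L : Type*} [Field L] [CharP L p] [Algebra K L] (f : ℕ → Polynomial K)
    (x : WittVector p L) : WittVector p L :=
  letI : TopologicalSpace (WittVector p L) := wittTopology p L
  ∑' i : ℕ, (p : WittVector p L) ^ i *
    (teichPoly p (f i)).eval₂ (WittVector.map (algebraMap K L)) x

end WittRing

section ExponentialSum

variable (p : ℕ) [Fact p.Prime] {K : Type*} [Field K] [Finite K] [CharP K p]

instance charP_extension (k : ℕ) [NeZero k] : CharP (FiniteField.Extension K p k) p :=
  charP_of_injective_algebraMap (algebraMap K (FiniteField.Extension K p k)).injective p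

/-- The `T`-adic exponential sum `S_f(T, k)`: the sum of `(1 + T) ^ Tr(f̂(x))` over the roots of
unity `x` of order dividing `q ^ k - 1` in `W(𝔽_{q^k})`, where `K = 𝔽_q`. -/
noncomputable def expSum (f : ℕ → Polynomial K) (k : ℕ) [NeZero k] : ℤ_[p]⟦X⟧ :=
  ∑ x ∈ Polynomial.nthRootsFinset (Nat.card K ^ k - 1)
      (1 : WittVector p (FiniteField.Extension K p k)),
    binomialSeries ℤ_[p] (wittTrace p (fHat p f x))

/-- The series `-∑_{k ≥ 1} S_f(T, k) s ^ k / (k (q ^ k - 1))` in `s` over `ℚ_p⟦T⟧`. -/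
noncomputable def cExponent (f : ℕ → Polynomial K) : ℚ_[p]⟦X⟧⟦X⟧ :=
  PowerSeries.mk fun
    | 0 => 0
    | k + 1 => -(C (((k + 1 : ℕ) : ℚ_[p]) * ((Nat.card K : ℚ_[p]) ^ (k + 1) - 1))⁻¹ *
        PowerSeries.map PadicInt.Coe.ringHom (expSum p f (k + 1)))

/-- The function `C_f(T, s)`, a power series in `s` over `ℚ_p⟦T⟧`. -/
noncomputable def cFunction (f : ℕ → Polynomial K) : ℚ_[p]⟦X⟧⟦X⟧ :=
  (PowerSeries.exp ℚ_[p]⟦X⟧).subst (cExponent p f)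

end ExponentialSum

section Dwork

variable (p : ℕ) [Fact p.Prime] {K : Type*} [Field K] [CharP K p]

open scoped PowerSeries.WithPiTopology

/-- The value `E(y) = ∑_n e_n y ^ n` of the Artin-Hasse series at an element `y` of
`W(K)⟦T⟧⟦x⟧`, a ring with the topology of coefficientwise `p`-adic convergence. -/
noncomputable def artinHasseEval (y : (WittVector p K)⟦X⟧⟦X⟧) : (WittVector p K)⟦X⟧⟦X⟧ :=
  letI : TopologicalSpace (WittVector p K) := wittTopology p K
  ∑' n : ℕ, C (C (padicIntToWitt p (coeff n (artinHasse p)))) * y ^ n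

/-- `E_h(x, η) = ∏_u E(η ĥ_u x ^ u)` for a polynomial `h` and `η` in `ℤ_p⟦T⟧`. -/
noncomputable def splitFactor (h : Polynomial K) (η : ℤ_[p]⟦X⟧) : (WittVector p K)⟦X⟧⟦X⟧ :=
  ∏ u ∈ Finset.range (h.natDegree + 1),
    artinHasseEval p (C (PowerSeries.map (padicIntToWitt p) η *
      C (WittVector.teichmuller p (h.coeff u))) * X ^ u)

/-- Convergence of the product `E_f(x) = ∏_i E_{f_i}(x, π_i)`. -/
def SplitConverges (f : ℕ → Polynomial K) : Prop :=
  letI : TopologicalSpace (WittVector p K) := wittTopology p K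
  Multipliable fun i : ℕ => splitFactor p (f i) (piSeries p i)

/-- The series `E_f(x) = ∏_i E_{f_i}(x, π_i)` in `W(K)⟦T⟧⟦x⟧`. -/
noncomputable def splitSeries (f : ℕ → Polynomial K) : (WittVector p K)⟦X⟧⟦X⟧ :=
  letI : TopologicalSpace (WittVector p K) := wittTopology p K
  ∏' i : ℕ, splitFactor p (f i) (piSeries p i)

/-- The operator `∑ b_u x ^ u ↦ ∑ b_{pu} x ^ u`. -/
noncomputable def phiP {R : Type*} [CommRing R] (g : R⟦X⟧) : R⟦X⟧ :=
  PowerSeries.mk fun u => coeff (p * u) g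

/-- The Dwork operator `φ = σ⁻¹ ∘ φ_p ∘ E_f(x)` on `W(K)⟦T⟧⟦x⟧`, where `σ` is the Frobenius
automorphism of `W(K)`, acting on coefficients. -/
noncomputable def dworkOp [PerfectRing K p] (f : ℕ → Polynomial K)
    (g : (WittVector p K)⟦X⟧⟦X⟧) : (WittVector p K)⟦X⟧⟦X⟧ :=
  PowerSeries.map
    (PowerSeries.map ((WittVector.frobeniusEquiv p K).symm : WittVector p K →+* WittVector p K))
    (phiP p (splitSeries p f * g))

/-- The matrix of the `r`-th iterate of the Dwork operator in the basis `1, x, x ^ 2, …`: its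
`v`-th column holds the coefficients of `φ^r (x ^ v)`. The operator is `σ⁻¹`-semilinear, so the
matrix of `φ^r` is the product `M · σ⁻¹(M) ⋯ σ^{-(r-1)}(M)`, where `M` is the case `r = 1`. -/
noncomputable def dworkMatrix [PerfectRing K p] (f : ℕ → Polynomial K) (r : ℕ) :
    Matrix ℕ ℕ (WittVector p K)⟦X⟧ :=
  Matrix.of fun u v => coeff u ((dworkOp p f)^[r] (X ^ v))

end Dwork

section Fredholm

variable {R : Type*} [CommRing R]

/-- The principal minor of an infinite matrix on a finite set of indices. -/
noncomputable def principalMinor (A : Matrix ℕ ℕ R⟦X⟧) (S : Finset ℕ) : R⟦X⟧ :=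
  (A.submatrix (Subtype.val : S → ℕ) (Subtype.val : S → ℕ)).det

/-- Existence of `det (I - sA)`: for each `n` the sum of the principal minors of size `n`
converges `T`-adically. -/
def HasFredholmDet (A : Matrix ℕ ℕ R⟦X⟧) : Prop :=
  letI : TopologicalSpace R⟦X⟧ := (Ideal.span {(X : R⟦X⟧)}).adicTopology
  ∀ n : ℕ, Summable fun S : {S : Finset ℕ // S.card = n} => principalMinor A S

/-- The determinant `det (I - sA) = ∑_n (-1) ^ n (∑_{|S| = n} det A_S) s ^ n` of an infinite
matrix over `R⟦T⟧`. -/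
noncomputable def fredholmDet (A : Matrix ℕ ℕ R⟦X⟧) : R⟦X⟧⟦X⟧ :=
  letI : TopologicalSpace R⟦X⟧ := (Ideal.span {(X : R⟦X⟧)}).adicTopology
  PowerSeries.mk fun n =>
    (-1) ^ n * ∑' S : {S : Finset ℕ // S.card = n}, principalMinor A S

/-- A power series `∑ b_n(T) s ^ n` is `T`-adically analytic (entire) in `s` if
`ord_T (b_n) / n → ∞`, that is, if it converges `T`-adically at every `s`. -/
def IsTAdicEntire (F : R⟦X⟧⟦X⟧) : Prop :=
  ∀ c : ℕ, ∀ᶠ n : ℕ in Filter.atTop, ((c * n : ℕ) : ℕ∞) ≤ (coeff n F).order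

end Fredholm

end TAdicWitt

/-!
Let `t_k` be the `k`-th weight `S_f(T, k) / (q ^ k - 1)` of `C_f(T, s)`. Logarithmic
differentiation gives `n b_n = -∑ t_i b_{n-i}` for its coefficients. Newton's identities for finite
matrices, applied to the upper left corners of `M ^ a` and passed to the `T`-adic limit, give the
same recursion for `det (I - s M ^ a)`, with `t_k` replaced by the trace of `M ^ (a k)`. So the
theorem reduces to Dwork's trace formula `S_f(T, k) = (q ^ k - 1) Tr (M ^ (a k))`.

By `φ_p ∘ g(x ^ p) = g(x) ∘ φ_p`, the entries of `M ^ (a k)` are the coefficients at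
`x ^ (q ^ k u - v)` of `F = ∏_{j < a k} σ ^ j (E_f) (x ^ (p ^ j))`. Summing `F` over the roots of
unity therefore gives `q ^ k - 1` times the sum of the diagonal entries. On the other hand the
Artin-Hasse factors of `F` at a Teichmüller point multiply up to `(1 + T) ^ Tr (f̂ (x))`, because
`E(π y) E(π y ^ p) ⋯ E(π y ^ (p ^ (r - 1)))` is `E(π) ^ Tr(y)` for a Teichmüller representative `y`
fixed by the `r`-th power of Frobenius.

All convergence comes from one estimate. Regarded as a power series in `T`, the series `E_f` has
polynomial coefficients, that of `T ^ m` being of degree at most `d m`. Hence the `(u, v)` entry of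
`M` has order at least `(p u - v) / d` in `T`, and since the row and column indices of a principal
minor of size `n` cancel up to the factor `p - 1`, its order is at least quadratic in `n`.
-/

namespace TAdicWitt

section Newton

theorem derivation_prod {R A ι : Type*} [CommRing R] [CommRing A] [Algebra R A] [DecidableEq ι]
    (δ : Derivation R A A) (s : Finset ι) (f : ι → A) :
    δ (∏ i ∈ s, f i) = ∑ i ∈ s, (∏ j ∈ s.erase i, f j) * δ (f i) := by
  induction s using Finset.induction_on with
  | empty => simp
  | insert a s ha ih =>
    rw [Finset.prod_insert ha, Derivation.leibniz, ih, Finset.sum_insert ha,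
      Finset.erase_insert ha, smul_eq_mul, smul_eq_mul, Finset.mul_sum, add_comm]
    congr 1
    refine Finset.sum_congr rfl fun i hi => ?_
    have hai : a ≠ i := fun h => ha (h ▸ hi)
    rw [Finset.erase_insert_of_ne hai, Finset.prod_insert (fun h => ha (Finset.mem_of_mem_erase h)),
      mul_assoc]

theorem derivation_det {R A n : Type*} [CommRing R] [CommRing A] [Algebra R A] [Fintype n]
    [DecidableEq n] (δ : Derivation R A A) (M : Matrix n n A) :
    δ M.det = (M.adjugate * M.map δ).trace := by
  have diag_eq_det : ∀ i, (M.adjugate * M.map δ) i i = (M.updateCol i fun j => δ (M j i)).det := by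
    intro i
    rw [← Matrix.cramer_apply, Matrix.cramer_eq_adjugate_mulVec]
    rfl
  simp only [Matrix.trace, Matrix.diag_apply, diag_eq_det, Matrix.det_apply]
  rw [map_sum, Finset.sum_comm]
  refine Finset.sum_congr rfl fun σ _ => ?_
  rw [← Finset.smul_sum, Units.smul_def, Units.smul_def, map_zsmul, derivation_prod]
  congr 1
  refine Finset.sum_congr rfl fun i _ => ?_
  rw [← Finset.prod_erase_mul _ _ (Finset.mem_univ i)]
  congr 1
  · refine Finset.prod_congr rfl fun j hj => ?_
    rw [Matrix.updateCol_ne (Finset.ne_of_mem_erase hj)]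
  · rw [Matrix.updateCol_self]

variable {R n : Type*} [CommRing R] [Fintype n] [DecidableEq n] (A : Matrix n n R)

open scoped Polynomial in
theorem coeff_matPolyEquiv_adjugate_one_sub_X_smul (j : ℕ) :
    (matPolyEquiv (1 - (Polynomial.X : R[X]) • A.map Polynomial.C).adjugate).coeff j =
      ∑ i ∈ Finset.range (j + 1), A.charpolyRev.coeff (j - i) • A ^ i := by
  set N := matPolyEquiv (1 - (Polynomial.X : R[X]) • A.map Polynomial.C).adjugate
  have adjugate_mul : N * (1 - Polynomial.X * Polynomial.C A) =
      A.charpolyRev.map (algebraMap R (Matrix n n R)) := by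
    have hA : matPolyEquiv (1 - (Polynomial.X : R[X]) • A.map Polynomial.C) =
        1 - Polynomial.X * Polynomial.C A := by
      rw [← mul_one ((Polynomial.X : R[X]) • A.map Polynomial.C), Matrix.smul_mul,
        ← Matrix.mul_smul, map_sub, map_one, map_mul, matPolyEquiv_smul_one, matPolyEquiv_map_C,
        Polynomial.map_X, Polynomial.X_mul]
    rw [← hA, ← map_mul, Matrix.adjugate_mul, matPolyEquiv_smul_one, Matrix.charpolyRev]
  have coeff_sub (i : ℕ) :
      (N * (1 - Polynomial.X * Polynomial.C A)).coeff i = A.charpolyRev.coeff i • 1 := by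
    rw [adjugate_mul, Polynomial.coeff_map, Algebra.algebraMap_eq_smul_one]
  simp only [mul_sub, mul_one, ← mul_assoc, Polynomial.coeff_sub,
    Polynomial.coeff_mul_C] at coeff_sub
  induction j with
  | zero => simpa using coeff_sub 0
  | succ j ih =>
    rw [← sub_add_cancel (N.coeff (j + 1)) (N.coeff j * A), ← Polynomial.coeff_mul_X N j, coeff_sub,
      Polynomial.coeff_mul_X, ih, Finset.sum_range_succ' _ (j + 1), Finset.sum_mul, add_comm]
    simp [pow_succ]

open scoped Polynomial in
theorem coeff_charpolyRev_succ_mul (m : ℕ) :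
    A.charpolyRev.coeff (m + 1) * (m + 1) =
      -∑ i ∈ Finset.range (m + 1), (A ^ (i + 1)).trace * A.charpolyRev.coeff (m - i) := by
  set M : Matrix n n R[X] := 1 - (Polynomial.X : R[X]) • A.map Polynomial.C
  have map_derivative : M.map (Polynomial.derivative' (R := R)) = -A.map Polynomial.C := by
    ext u v : 2
    by_cases huv : u = v <;> simp [M, huv]
  have coeff_mul_map_C (u : n) : ((M.adjugate * A.map Polynomial.C) u u).coeff m =
      ((matPolyEquiv M.adjugate).coeff m * A) u u := by
    simp [Matrix.mul_apply, Polynomial.finsetSum_coeff]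
  calc A.charpolyRev.coeff (m + 1) * (m + 1)
      = (Polynomial.derivative' (R := R) M.det).coeff m :=
        (Polynomial.coeff_derivative A.charpolyRev m).symm
    _ = -((matPolyEquiv M.adjugate).coeff m * A).trace := by
      rw [derivation_det, map_derivative, mul_neg, Matrix.trace_neg, Polynomial.coeff_neg]
      simp only [Matrix.trace, Matrix.diag_apply, Polynomial.finsetSum_coeff, coeff_mul_map_C]
    _ = _ := by
      rw [coeff_matPolyEquiv_adjugate_one_sub_X_smul, Finset.sum_mul, Matrix.trace_sum]
      simp only [Matrix.smul_mul, Matrix.trace_smul, smul_eq_mul, pow_succ, mul_comm]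

theorem coeff_charpolyRev_eq_sum_minors (k : ℕ) :
    A.charpolyRev.coeff k = (-1) ^ k * ∑ s ∈ Finset.univ.powersetCard k,
      (A.submatrix (Subtype.val : s → n) (Subtype.val : s → n)).det := by
  have hA : A.charpolyRev = (1 + (Polynomial.X : Polynomial R) • (-A).map Polynomial.C).det := by
    rw [Matrix.charpolyRev, sub_eq_add_neg, Matrix.map_neg _ (map_neg _), smul_neg]
  rw [hA, Matrix.coeff_det_one_add_X_smul_eq_sum_minors, Finset.mul_sum]
  refine Finset.sum_congr rfl fun s hs => ?_
  rw [Matrix.submatrix_neg, Pi.neg_apply, Pi.neg_apply, Matrix.det_neg, Fintype.card_coe,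
    (Finset.mem_powersetCard.mp hs).2]

end Newton

section AdicTopology

open Filter Topology

variable {R : Type*} [CommRing R]

theorem t2Space_adicTopology (I : Ideal R) [IsHausdorff I R] : @T2Space R I.adicTopology :=
  letI : TopologicalSpace R := I.adicTopology
  (IsAdic.isHausdorff_iff rfl).1 ‹IsHausdorff I R›

theorem tendsto_adicTopology_span_singleton_iff {α : Type*} {l : Filter α} {f : α → R} {ϖ a : R} :
    Tendsto f l (@nhds R (Ideal.span {ϖ}).adicTopology a) ↔
      ∀ N, ∀ᶠ i in l, ϖ ^ N ∣ f i - a := by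
  let : TopologicalSpace R := (Ideal.span {ϖ}).adicTopology
  refine ((Ideal.span {ϖ}).hasBasis_nhds_adic a).tendsto_right_iff.trans ?_
  simp only [true_imp_iff, Ideal.span_singleton_pow, Set.image_add_left, Set.mem_preimage,
    SetLike.mem_coe, Ideal.mem_span_singleton, neg_add_eq_sub]

theorem eq_of_forall_pow_dvd_sub {ϖ : R} [IsHausdorff (Ideal.span {ϖ}) R] {x y : R}
    (h : ∀ N, ϖ ^ N ∣ x - y) : x = y := by
  refine sub_eq_zero.1 (IsHausdorff.haus (I := Ideal.span {ϖ}) (M := R) inferInstance _ fun N => ?_)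
  rw [SModEq.zero, smul_eq_mul, Ideal.mul_top, Ideal.span_singleton_pow,
    Ideal.mem_span_singleton]
  exact h N

theorem exists_forall_pow_dvd_sub {ϖ : R} [IsPrecomplete (Ideal.span {ϖ}) R] {x : ℕ → R}
    (h : ∀ m n, m ≤ n → ϖ ^ m ∣ x n - x m) : ∃ y, ∀ n, ϖ ^ n ∣ x n - y := by
  simpa only [SModEq.sub_mem, smul_eq_mul, Ideal.mul_top, Ideal.span_singleton_pow,
    Ideal.mem_span_singleton] using IsPrecomplete.prec (I := Ideal.span {ϖ}) (M := R) inferInstance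
    (f := x) fun {m n} hmn => by
      rw [SModEq.sub_mem, smul_eq_mul, Ideal.mul_top, Ideal.span_singleton_pow,
        Ideal.mem_span_singleton, dvd_sub_comm]
      exact h m n hmn

theorem hasSum_adicTopology_X {ι : Type*} {f : ι → R⟦X⟧} {g : R⟦X⟧} (s : ℕ → Finset ι)
    (hf : ∀ m, ∀ i ∉ s m, coeff m (f i) = 0) (hg : ∀ m, coeff m g = ∑ i ∈ s m, coeff m (f i)) :
    @HasSum _ _ _ (Ideal.span {(X : R⟦X⟧)}).adicTopology f g (SummationFilter.unconditional ι) := by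
  classical
  refine tendsto_adicTopology_span_singleton_iff.2 fun N =>
    eventually_atTop.2 ⟨(Finset.range N).biUnion s, fun t ht => X_pow_dvd_iff.2 fun m hm => ?_⟩
  have hst : s m ⊆ t := (Finset.subset_biUnion_of_mem s (Finset.mem_range.2 hm)).trans ht
  rw [map_sub, map_sum, hg, sub_eq_zero]
  exact (Finset.sum_subset hst fun i _ hi => hf m i hi).symm

end AdicTopology

section Fredholm

variable {R : Type*} [CommRing R]

theorem exists_coeff_ne_zero_of_coeff_mul_ne_zero {f g : R⟦X⟧} {m : ℕ}
    (h : coeff m (f * g) ≠ 0) : ∃ i j, i + j = m ∧ coeff i f ≠ 0 ∧ coeff j g ≠ 0 := by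
  rw [coeff_mul] at h
  obtain ⟨⟨i, j⟩, hij, hne⟩ := Finset.exists_ne_zero_of_sum_ne_zero h
  exact ⟨i, j, Finset.HasAntidiagonal.mem_antidiagonal.1 hij, left_ne_zero_of_mul hne,
    right_ne_zero_of_mul hne⟩

theorem sum_le_of_coeff_prod_ne_zero {ι : Type*} {s : Finset ι} {f : ι → R⟦X⟧} {c e : ι → ℕ} {d : ℕ}
    (h : ∀ i ∈ s, ∀ m, coeff m (f i) ≠ 0 → c i ≤ d * m + e i) {m : ℕ}
    (hm : coeff m (∏ i ∈ s, f i) ≠ 0) : ∑ i ∈ s, c i ≤ d * m + ∑ i ∈ s, e i := by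
  classical
  induction s using Finset.induction_on generalizing m with
  | empty => simp
  | insert a s ha ih =>
    rw [Finset.prod_insert ha] at hm
    obtain ⟨i, j, rfl, hi, hj⟩ := exists_coeff_ne_zero_of_coeff_mul_ne_zero hm
    have le_head := h a (Finset.mem_insert_self a s) i hi
    have le_tail := ih (fun i hi => h i (Finset.mem_insert_of_mem hi)) hj
    rw [Finset.sum_insert ha, Finset.sum_insert ha, mul_add]
    omega

theorem card_mul_pred_le_two_mul_sum (S : Finset ℕ) : S.card * (S.card - 1) ≤ 2 * ∑ u ∈ S, u := by
  have sum_range_le : ∑ i ∈ Finset.range S.card, i ≤ ∑ u ∈ S, u := by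
    zify
    simpa using Finset.sum_range_le_sum (s := S.map Nat.castEmbedding) (c := 0) (by simp)
  rw [← Finset.sum_range_id_mul_two, mul_comm]
  exact Nat.mul_le_mul_left 2 sum_range_le

/-- The decay of an infinite matrix of power series in `T` under which its principal minors of
size `n` have order at least quadratic in `n`: the coefficient of `T ^ m` in the entry `(u, v)`
vanishes unless `2 * u ≤ d * m + v`. Any factor larger than `1` in front of `u` would do; the Dwork
matrix satisfies this with `p` in place of `2`. -/
def Decays (d : ℕ) (A : Matrix ℕ ℕ R⟦X⟧) : Prop :=
  ∀ u v m, coeff m (A u v) ≠ 0 → 2 * u ≤ d * m + v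

/-- The trace of an infinite matrix of power series in `T`, as a `T`-adically convergent sum. -/
noncomputable def adicTrace (A : Matrix ℕ ℕ R⟦X⟧) : R⟦X⟧ :=
  letI : TopologicalSpace R⟦X⟧ := (Ideal.span {(X : R⟦X⟧)}).adicTopology
  ∑' u, A u u

/-- The upper left corner of size `r` of an infinite matrix. -/
def corner (r : ℕ) (A : Matrix ℕ ℕ R⟦X⟧) : Matrix (Fin r) (Fin r) R⟦X⟧ :=
  A.submatrix Fin.val Fin.val

theorem coeff_charpolyRev_corner (A : Matrix ℕ ℕ R⟦X⟧) (r n : ℕ) :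
    (corner r A).charpolyRev.coeff n =
      (-1) ^ n * ∑ S ∈ (Finset.range r).powersetCard n, principalMinor A S := by
  have range_eq_map : Finset.range r = Finset.univ.map (Fin.valEmbedding (n := r)) := by
    ext x; simp
  rw [coeff_charpolyRev_eq_sum_minors, range_eq_map, Finset.powersetCard_map, Finset.sum_map]
  refine congrArg _ (Finset.sum_congr rfl fun S _ => ?_)
  exact Matrix.det_submatrix_equiv_self (S.equivMap Fin.valEmbedding)
    (A.submatrix (Subtype.val : ↥(S.map Fin.valEmbedding) → ℕ) Subtype.val)

namespace Decays

variable {d : ℕ} {A : Matrix ℕ ℕ R⟦X⟧}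

theorem X_pow_dvd (hA : Decays d A) {u v N : ℕ} (h : d * N + v < 2 * u) : X ^ N ∣ A u v := by
  refine X_pow_dvd_iff.2 fun m hm => ?_
  by_contra hne
  have := hA u v m hne
  have := Nat.mul_le_mul_left d hm.le
  omega

theorem sum_le_of_coeff_principalMinor_ne_zero (hA : Decays d A) {S : Finset ℕ} {m : ℕ}
    (h : coeff m (principalMinor A S) ≠ 0) : ∑ u ∈ S, u ≤ d * m := by
  rw [principalMinor, Matrix.det_apply, map_sum] at h
  obtain ⟨σ, -, hσ⟩ := Finset.exists_ne_zero_of_sum_ne_zero h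
  rw [Units.smul_def, map_zsmul] at hσ
  have sum_le := sum_le_of_coeff_prod_ne_zero (e := fun i : S => (i : ℕ))
    (fun i _ _ => hA (σ i : S) i _) (right_ne_zero_of_smul hσ)
  rw [← Finset.mul_sum, Equiv.sum_comp σ (fun i : S => (i : ℕ)),
    Finset.sum_coe_sort S (fun u => u)] at sum_le
  omega

theorem subset_range_of_coeff_principalMinor_ne_zero (hA : Decays d A) {S : Finset ℕ} {m : ℕ}
    (h : coeff m (principalMinor A S) ≠ 0) : S ⊆ Finset.range (d * m + 1) := fun _ hu =>
  Finset.mem_range_succ_iff.2 <|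
    (Finset.single_le_sum (f := id) (fun _ _ => Nat.zero_le _) hu).trans
      (hA.sum_le_of_coeff_principalMinor_ne_zero h)

theorem hasSum_principalMinor (hA : Decays d A) (n : ℕ) :
    letI : TopologicalSpace R⟦X⟧ := (Ideal.span {(X : R⟦X⟧)}).adicTopology
    HasSum (fun S : {S : Finset ℕ // S.card = n} => principalMinor A S)
      (PowerSeries.mk fun m => ∑ S ∈ (Finset.range (d * m + 1)).powersetCard n,
        coeff m (principalMinor A S)) := by
  refine hasSum_adicTopology_X (fun m => (Finset.range (d * m + 1)).powerset.subtype _) ?_ ?_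
  · intro m S hS
    by_contra h
    exact hS (by simpa using hA.subset_range_of_coeff_principalMinor_ne_zero h)
  · intro m
    rw [coeff_mk, Finset.sum_subtype_eq_sum_filter (f := fun S => coeff m (principalMinor A S)),
      Finset.powersetCard_eq_filter]

theorem hasFredholmDet (hA : Decays d A) : HasFredholmDet A := fun n =>
  letI : TopologicalSpace R⟦X⟧ := (Ideal.span {(X : R⟦X⟧)}).adicTopology
  (hA.hasSum_principalMinor n).summable

theorem coeff_coeff_fredholmDet (hA : Decays d A) (n : ℕ) {m r : ℕ} (hr : d * m < r) :
    coeff m (coeff n (fredholmDet A)) = coeff m ((corner r A).charpolyRev.coeff n) := by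
  let : TopologicalSpace R⟦X⟧ := (Ideal.span {(X : R⟦X⟧)}).adicTopology
  have := t2Space_adicTopology (Ideal.span {(X : R⟦X⟧)})
  have neg_one_pow : ((-1) ^ n : R⟦X⟧) = C ((-1) ^ n) := by simp
  rw [fredholmDet, coeff_mk, (hA.hasSum_principalMinor n).tsum_eq, coeff_charpolyRev_corner,
    neg_one_pow, coeff_C_mul, coeff_C_mul, coeff_mk, map_sum]
  refine congrArg _ (Finset.sum_subset
    (Finset.powersetCard_mono (Finset.range_subset_range.2 hr)) fun S hS hS' => ?_)
  by_contra h
  exact hS' (Finset.mem_powersetCard.2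
    ⟨hA.subset_range_of_coeff_principalMinor_ne_zero h, (Finset.mem_powersetCard.1 hS).2⟩)

theorem coeff_zero_fredholmDet (hA : Decays d A) : coeff 0 (fredholmDet A) = 1 := by
  ext m
  rw [hA.coeff_coeff_fredholmDet 0 (Nat.lt_succ_self _), Polynomial.coeff_zero_eq_eval_zero,
    Matrix.eval_charpolyRev]

theorem X_pow_dvd_fredholmDet_sub (hA : Decays d A) (N n : ℕ) :
    X ^ N ∣ coeff n (fredholmDet A) - (corner (d * N + 1) A).charpolyRev.coeff n := by
  refine X_pow_dvd_iff.2 fun m hm => ?_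
  rw [map_sub, hA.coeff_coeff_fredholmDet n (Nat.lt_succ_of_le (Nat.mul_le_mul_left d hm.le)),
    sub_self]

theorem coeff_adicTrace (hA : Decays d A) {m r : ℕ} (hr : d * m < r) :
    coeff m (adicTrace A) = ∑ u ∈ Finset.range r, coeff m (A u u) := by
  let : TopologicalSpace R⟦X⟧ := (Ideal.span {(X : R⟦X⟧)}).adicTopology
  have := t2Space_adicTopology (Ideal.span {(X : R⟦X⟧)})
  have coeff_diag_eq_zero (m u : ℕ) (h : u ∉ Finset.range (d * m + 1)) :
      coeff m (A u u) = 0 := by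
    by_contra hne
    have := hA u u m hne
    have : d * m + 1 ≤ u := by simpa using h
    omega
  have hasSum_diag : HasSum (fun u => A u u)
      (PowerSeries.mk fun m => ∑ u ∈ Finset.range (d * m + 1), coeff m (A u u)) :=
    hasSum_adicTopology_X (fun m => Finset.range (d * m + 1)) coeff_diag_eq_zero
      fun m => coeff_mk _ _
  rw [adicTrace, hasSum_diag.tsum_eq, coeff_mk]
  exact Finset.sum_subset (Finset.range_subset_range.2 hr) fun u _ hu =>
    coeff_diag_eq_zero m u hu

theorem X_pow_dvd_adicTrace_sub (hA : Decays d A) (N : ℕ) :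
    X ^ N ∣ adicTrace A - ∑ u ∈ Finset.range (d * N + 1), A u u := by
  refine X_pow_dvd_iff.2 fun m hm => ?_
  rw [map_sub, map_sum, hA.coeff_adicTrace (Nat.lt_succ_of_le (Nat.mul_le_mul_left d hm.le)),
    sub_self]

theorem isTAdicEntire_fredholmDet (hA : Decays d A) : IsTAdicEntire (fredholmDet A) := by
  intro c
  filter_upwards [Filter.eventually_ge_atTop (2 * (d * c) + 2)] with n hn
  refine nat_le_order _ _ fun m hm => ?_
  have hmn : 2 * (d * m) < n * (n - 1) :=
    calc 2 * (d * m) ≤ 2 * (d * (c * n)) := by gcongr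
      _ = n * (2 * (d * c)) := by ring
      _ < n * (n - 1) := Nat.mul_lt_mul_of_pos_left (by omega) (by omega)
  have neg_one_pow : ((-1) ^ n : R⟦X⟧) = C ((-1) ^ n) := by simp
  rw [hA.coeff_coeff_fredholmDet n (Nat.lt_succ_self _), coeff_charpolyRev_corner, neg_one_pow,
    coeff_C_mul, map_sum, Finset.sum_eq_zero, mul_zero]
  intro S hS
  by_contra hne
  have sum_le := hA.sum_le_of_coeff_principalMinor_ne_zero hne
  have le_sum := card_mul_pred_le_two_mul_sum S
  rw [(Finset.mem_powersetCard.1 hS).2] at le_sum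
  omega

end Decays

theorem isTAdicEntire_of_map {S : Type*} [CommRing S] {φ : R →+* S} (hφ : Function.Injective φ)
    {F : R⟦X⟧⟦X⟧} (h : IsTAdicEntire (PowerSeries.map (PowerSeries.map φ) F)) :
    IsTAdicEntire F := by
  intro c
  filter_upwards [h c] with n hn
  refine nat_le_order _ _ fun m hm => hφ ?_
  rw [← coeff_map, ← coeff_map, map_zero]
  exact coeff_of_lt_order m ((Nat.cast_lt.2 hm).trans_le hn)

/-- `B k` is the `k`-th power of the infinite matrix `A`, for `k ≥ 1`. The row `u` of `A` vanishes
from the column `b u` on, which makes the matrix products finite sums. -/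
structure IsPowers (b : ℕ → ℕ) (A : Matrix ℕ ℕ R⟦X⟧) (B : ℕ → Matrix ℕ ℕ R⟦X⟧) : Prop where
  one : B 1 = A
  succ : ∀ k u v, B (k + 1) u v = ∑ w ∈ Finset.range (b u), A u w * B k w v
  row : ∀ u w, b u ≤ w → A u w = 0

namespace IsPowers

variable {d : ℕ} {A : Matrix ℕ ℕ R⟦X⟧} {b : ℕ → ℕ} {B : ℕ → Matrix ℕ ℕ R⟦X⟧}

theorem decays (hB : IsPowers b A B) (hA : Decays d A) (k : ℕ) : Decays d (B (k + 1)) := by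
  induction k with
  | zero => rwa [zero_add, hB.one]
  | succ k ih =>
    intro u v m hm
    rw [hB.succ, map_sum] at hm
    obtain ⟨w, -, hw⟩ := Finset.exists_ne_zero_of_sum_ne_zero hm
    obtain ⟨i, j, rfl, hi, hj⟩ := exists_coeff_ne_zero_of_coeff_mul_ne_zero hw
    have := hA u w i hi
    have := ih w v j hj
    rw [mul_add]
    omega

theorem apply_succ_eq_sum_range (hB : IsPowers b A B) (k u v : ℕ) {r : ℕ} (hr : b u ≤ r) :
    B (k + 1) u v = ∑ w ∈ Finset.range r, A u w * B k w v := by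
  rw [hB.succ]
  refine Finset.sum_subset (Finset.range_subset_range.2 hr) fun w _ hw => ?_
  rw [hB.row u w (by simpa using hw), zero_mul]

theorem X_pow_dvd_sub_corner_pow (hB : IsPowers b A B) (hA : Decays d A) {N r : ℕ}
    (hr : r = d * N + 1) (k : ℕ) (u v : Fin r) :
    X ^ N ∣ B (k + 1) u v - (corner r A ^ (k + 1)) u v := by
  induction k generalizing u v with
  | zero => simp [hB.one, corner]
  | succ k ih =>
    have truncate : X ^ N ∣
        B (k + 1 + 1) u v - ∑ w ∈ Finset.range r, A u w * B (k + 1) w v := by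
      rw [hB.apply_succ_eq_sum_range _ _ _ (le_max_right r (b u)),
        ← Finset.sum_sdiff (Finset.range_subset_range.2 (le_max_left r (b u))),
        add_sub_cancel_right]
      refine Finset.dvd_sum fun w hw => ((hB.decays hA k).X_pow_dvd ?_).mul_left _
      have hrw : r ≤ w := by simpa using (Finset.mem_sdiff.1 hw).2
      have := v.2
      omega
    have replace_powers : X ^ N ∣ ∑ w ∈ Finset.range r, A u w * B (k + 1) w v -
        (corner r A ^ (k + 1 + 1)) u v := by
      rw [pow_succ' _ (k + 1), Matrix.mul_apply, Finset.sum_range, ← Finset.sum_sub_distrib]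
      refine Finset.dvd_sum fun w _ => ?_
      rw [show corner r A u w = A u w from rfl, ← mul_sub]
      exact (ih w v).mul_left _
    simpa using truncate.add replace_powers

theorem X_pow_dvd_adicTrace_sub_trace_corner_pow (hB : IsPowers b A B) (hA : Decays d A)
    (N k : ℕ) : X ^ N ∣ adicTrace (B (k + 1)) - (corner (d * N + 1) A ^ (k + 1)).trace := by
  have corner_sum : X ^ N ∣ ∑ u ∈ Finset.range (d * N + 1), B (k + 1) u u -
      (corner (d * N + 1) A ^ (k + 1)).trace := by
    rw [Finset.sum_range, Matrix.trace, ← Finset.sum_sub_distrib]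
    exact Finset.dvd_sum fun u _ => hB.X_pow_dvd_sub_corner_pow hA rfl k u u
  simpa using ((hB.decays hA k).X_pow_dvd_adicTrace_sub N).add corner_sum

theorem coeff_fredholmDet_succ_mul (hB : IsPowers b A B) (hA : Decays d A) (n : ℕ) :
    coeff (n + 1) (fredholmDet A) * (n + 1) =
      -∑ i ∈ Finset.range (n + 1), adicTrace (B (i + 1)) * coeff (n - i) (fredholmDet A) := by
  refine eq_of_forall_pow_dvd_sub (ϖ := (X : R⟦X⟧)) fun N => ?_
  have newton := coeff_charpolyRev_succ_mul (corner (d * N + 1) A) n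
  have det_congr := hA.X_pow_dvd_fredholmDet_sub N
  have trace_congr := hB.X_pow_dvd_adicTrace_sub_trace_corner_pow hA N
  simp only [← Ideal.mem_span_singleton, ← Ideal.Quotient.mk_eq_mk_iff_sub_mem] at *
  simpa only [map_mul, map_add, map_neg, map_sum, det_congr, trace_congr]
    using congrArg (Ideal.Quotient.mk (Ideal.span {X ^ N})) newton

end IsPowers

end Fredholm

section SpanAndTrace

variable {A : Type*} [CommRing A] {ι : Type*}

theorem isPrecomplete_pi [Finite ι] (I : Ideal A) [IsPrecomplete I A] :
    IsPrecomplete I (ι → A) := by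
  classical
  have : Fintype ι := Fintype.ofFinite ι
  refine AdicCompletion.of_surjective_iff.1 fun x => ?_
  choose y hy using fun j =>
    AdicCompletion.of_surjective I A (AdicCompletion.piEquivOfFintype I (fun _ : ι => A) x j)
  refine ⟨y, (AdicCompletion.piEquivOfFintype I fun _ : ι => A).injective (funext fun j => ?_)⟩
  rw [← hy, AdicCompletion.piEquivOfFintype_apply]
  rfl

variable [Fintype ι]

theorem span_range_eq_top_of_mkQ {M : Type*} [AddCommGroup M] [Module A M] {I : Ideal A}
    [IsPrecomplete I A] [IsHausdorff I M] {e : ι → M}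
    (he : ∀ w, ∃ c : ι → A, w - ∑ i, c i • e i ∈ (I • ⊤ : Submodule A M)) :
    Submodule.span A (Set.range e) = ⊤ := by
  have := isPrecomplete_pi (ι := ι) I
  rw [← Fintype.range_linearCombination A e, LinearMap.range_eq_top]
  refine surjective_of_mkQ_comp_surjective (I := I) fun w => ?_
  obtain ⟨w, rfl⟩ := Submodule.mkQ_surjective _ w
  obtain ⟨c, hc⟩ := he w
  exact ⟨c, ((Submodule.Quotient.eq _).2 hc).symm⟩

variable {B C : Type*} [CommRing B] [Algebra A B] [CommRing C] [IsDomain C] [Algebra A C]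
  {σ : ι → B →ₐ[A] C} {e : ι → B}

theorem det_algHom_ne_zero [DecidableEq ι] (hσ : Function.Injective σ)
    (he : Submodule.span A (Set.range e) = ⊤) : (Matrix.of fun j i => σ j (e i)).det ≠ 0 := by
  rw [Ne, ← Matrix.exists_vecMul_eq_zero_iff]
  rintro ⟨v, hv0, hv⟩
  have hindep := (linearIndependent_monoidHom B C).comp (fun j => (σ j : B →* C))
    fun i j h => hσ (AlgHom.ext fun w => DFunLike.congr_fun h w)
  have hzero : ∑ j, v j • (σ j).toLinearMap = (0 : B →ₗ[A] C) := by
    refine LinearMap.ext_on_range he fun i => ?_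
    simpa [Matrix.vecMul, dotProduct] using congrFun hv i
  refine hv0 (funext (Fintype.linearIndependent_iff.1 hindep v (funext fun w => ?_)))
  simpa using LinearMap.congr_fun hzero w

theorem linearIndependent_of_det_algHom_ne_zero [DecidableEq ι] [FaithfulSMul A C]
    (hdet : (Matrix.of fun j i => σ j (e i)).det ≠ 0) : LinearIndependent A e := by
  refine Fintype.linearIndependent_iff.2 fun c hc i => ?_
  have hker : (Matrix.of fun j i => σ j (e i)).mulVec (fun i => algebraMap A C (c i)) = 0 := by
    funext j
    simpa [Matrix.mulVec, dotProduct, Algebra.smul_def, mul_comm] using congrArg (σ j) hc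
  exact (FaithfulSMul.algebraMap_eq_zero_iff A C).1
    (congrFun (Matrix.eq_zero_of_mulVec_eq_zero hdet hker) i)

/- In the coordinates `w ↦ (σ_j w)_j`, multiplication by `y` becomes diagonal. -/
theorem algebraMap_trace_eq_sum_algHom [FaithfulSMul A C] (hσ : Function.Injective σ)
    (he : Submodule.span A (Set.range e) = ⊤) (y : B) :
    algebraMap A C (Algebra.trace A B y) = ∑ j, σ j y := by
  classical
  have hdet := det_algHom_ne_zero hσ he
  let b := Module.Basis.mk (linearIndependent_of_det_algHom_ne_zero hdet) he.ge
  have hb : ⇑b = e := Module.Basis.coe_mk _ _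
  set F : Matrix ι ι C := Matrix.of fun j i => σ j (e i) with hF
  set Y : Matrix ι ι C := (Algebra.leftMulMatrix b y).map (algebraMap A C) with hY
  have hdiag : Matrix.diagonal (fun j => σ j y) * F = F * Y := by
    ext j i
    have hmul : y * e i = ∑ k, Algebra.leftMulMatrix b y k i • e k := by
      simp only [Algebra.leftMulMatrix_eq_repr_mul, ← hb, b.sum_repr]
    rw [Matrix.diagonal_mul, Matrix.mul_apply, hF, hY, Matrix.of_apply, ← map_mul, hmul, map_sum]
    refine Finset.sum_congr rfl fun k _ => ?_
    rw [map_smul, Algebra.smul_def, mul_comm, Matrix.of_apply, Matrix.map_apply]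
  have htrace : F.det * Y.trace = F.det * ∑ j, σ j y := by
    have h := congrArg (fun Z => (F.adjugate * Z).trace) hdiag
    rw [← mul_assoc, Matrix.trace_mul_comm, ← mul_assoc, ← mul_assoc, Matrix.mul_adjugate,
      Matrix.adjugate_mul, Matrix.smul_mul, Matrix.smul_mul, one_mul, one_mul, Matrix.trace_smul,
      Matrix.trace_smul, Matrix.trace_diagonal] at h
    exact h.symm
  rw [Algebra.trace_eq_matrix_trace b, ← mul_left_cancel₀ hdet htrace, hY, Matrix.trace, map_sum]
  rfl

end SpanAndTrace

section Witt

variable (p : ℕ) [Fact p.Prime]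

theorem teichmuller_injective {L : Type*} [CommRing L] :
    Function.Injective (WittVector.teichmuller p : L → WittVector p L) :=
  Function.LeftInverse.injective (g := WittVector.constantCoeff)
    (WittVector.teichmuller_coeff_zero p)

variable {L : Type*} [Field L] [CharP L p]

theorem padicIntToWitt_injective :
    Function.Injective (padicIntToWitt p : ℤ_[p] →+* WittVector p L) :=
  (WittVector.map_injective _ (ZMod.castHom (dvd_refl p) L).injective).comp
    (WittVector.equiv p).symm.injective

theorem frobenius_padicIntToWitt (z : ℤ_[p]) :
    WittVector.frobenius (padicIntToWitt p z : WittVector p L) = padicIntToWitt p z := by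
  ext n
  rw [WittVector.coeff_frobenius_charP]
  simp only [padicIntToWitt, RingHom.comp_apply, WittVector.map_coeff, ← map_pow, ZMod.pow_card]

theorem map_padicIntToWitt {K : Type*} [Field K] [CharP K p] (g : K →+* L) (z : ℤ_[p]) :
    WittVector.map g (padicIntToWitt p z) = padicIntToWitt p z := by
  ext n
  simp only [padicIntToWitt, RingHom.comp_apply, WittVector.map_coeff]
  exact RingHom.congr_fun (Subsingleton.elim (g.comp (ZMod.castHom (dvd_refl p) K)) _) _

theorem isLocalHom_padicIntToWitt :
    IsLocalHom (padicIntToWitt p : ℤ_[p] →+* WittVector p L) := by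
  refine ⟨fun z hz => by_contra fun hnonunit => ?_⟩
  have hmem : z ∈ IsLocalRing.maximalIdeal ℤ_[p] := hnonunit
  rw [PadicInt.maximalIdeal_eq_span_p, Ideal.mem_span_singleton] at hmem
  have hdvd := map_dvd ((WittVector.constantCoeff (R := L)).comp (padicIntToWitt p)) hmem
  rw [map_natCast, CharP.cast_eq_zero, zero_dvd_iff] at hdvd
  exact (hz.map (WittVector.constantCoeff (R := L))).ne_zero hdvd

theorem dvd_of_map_dvd {A B : Type*} [CommRing A] [IsDomain A] [ValuationRing A] [CommRing B]
    [IsDomain B] {φ : A →+* B} [IsLocalHom φ] (hφ : Function.Injective φ) {x y : A}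
    (h : φ x ∣ φ y) : x ∣ y := by
  rcases ValuationRing.dvd_total x y with hxy | ⟨c, rfl⟩
  · exact hxy
  rcases eq_or_ne y 0 with rfl | hy
  · exact dvd_zero _
  rw [map_mul] at h
  have hc : IsUnit (φ c) := isUnit_of_dvd_one
    ((mul_dvd_mul_iff_left ((map_ne_zero_iff φ hφ).2 hy)).1 (by rwa [mul_one]))
  exact (isUnit_of_map_unit φ c hc).mul_right_dvd.2 dvd_rfl

/-- The `j`-th power of the Frobenius of the ring of Witt vectors, as a ring homomorphism. -/
noncomputable def frobPow (L : Type*) [CommRing L] (j : ℕ) :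
    WittVector p L →+* WittVector p L :=
  (WittVector.frobenius : WittVector p L →+* WittVector p L) ^ j

theorem frobPow_apply {L : Type*} [CommRing L] (j : ℕ) (w : WittVector p L) :
    frobPow p L j w = WittVector.frobenius^[j] w := by
  rw [frobPow, RingHom.coe_pow]

theorem frobPow_succ_apply {L : Type*} [CommRing L] (j : ℕ) (w : WittVector p L) :
    frobPow p L (j + 1) w = WittVector.frobenius (frobPow p L j w) := by
  rw [frobPow_apply, frobPow_apply, Function.iterate_succ_apply']

theorem frobPow_padicIntToWitt (j : ℕ) (z : ℤ_[p]) :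
    frobPow p L j (padicIntToWitt p z) = padicIntToWitt p z := by
  rw [frobPow_apply]
  exact Function.iterate_fixed (frobenius_padicIntToWitt p z) j

theorem frobPow_teichmuller (j : ℕ) (t : L) :
    frobPow p L j (WittVector.teichmuller p t) = WittVector.teichmuller p t ^ p ^ j := by
  have hfrob (t : L) : WittVector.frobenius (WittVector.teichmuller p t) =
      WittVector.teichmuller p (t ^ p) := by
    rw [WittVector.frobenius_eq_map_frobenius, WittVector.map_teichmuller, frobenius_def]
  rw [frobPow_apply, ← map_pow]
  induction j with
  | zero => simp
  | succ j ih => rw [Function.iterate_succ_apply', ih, hfrob, ← pow_mul, pow_succ]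

end Witt

section WittTrace

variable (p : ℕ) [Fact p.Prime] {L : Type*} [Field L] [Finite L] [CharP L p]

theorem frobPow_injective_of_card {r : ℕ} (hr : Nat.card L = p ^ r) :
    Function.Injective fun j : Fin r => frobPow p L j := by
  have hp := (Fact.out : p.Prime)
  have : Fintype L := Fintype.ofFinite L
  refine .of_lt_imp_ne fun i j hij h => ?_
  have hlt : p ^ (i : ℕ) < p ^ (j : ℕ) := Nat.pow_lt_pow_right hp.one_lt hij
  have hpow : ∀ t : Lˣ, t ^ (p ^ (j : ℕ) - p ^ (i : ℕ)) = 1 := fun t => by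
    have ht := RingHom.congr_fun h (WittVector.teichmuller p (t : L))
    simp only [frobPow_teichmuller, ← map_pow] at ht
    have heq : t ^ p ^ (i : ℕ) = t ^ p ^ (j : ℕ) :=
      Units.ext (by simpa using teichmuller_injective p ht)
    rw [pow_sub _ hlt.le, ← heq, mul_inv_cancel]
  rw [FiniteField.forall_pow_eq_one_iff, ← Nat.card_eq_fintype_card, hr] at hpow
  have hle := Nat.le_of_dvd (Nat.sub_pos_of_lt hlt) hpow
  have hone : 1 ≤ p ^ (i : ℕ) := Nat.one_le_pow _ _ hp.pos
  have hmax : p ^ (j : ℕ) < p ^ r := Nat.pow_lt_pow_right hp.one_lt j.2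
  omega

/-- `W(L)` as a `ℤ_p`-algebra, the structure used in `wittTrace`. -/
@[reducible]
noncomputable def wittAlgebra (L : Type*) [Field L] [CharP L p] : Algebra ℤ_[p] (WittVector p L) :=
  (padicIntToWitt p).toAlgebra

attribute [local instance] wittAlgebra

theorem span_teichmuller_eq_top {ι : Type*} [Finite ι] [Algebra (ZMod p) L]
    (b : Module.Basis ι (ZMod p) L) :
    Submodule.span ℤ_[p] (Set.range fun i => WittVector.teichmuller p (b i)) = ⊤ := by
  have : Fintype ι := Fintype.ofFinite ι
  have hpI := PadicInt.maximalIdeal_eq_span_p (p := p)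
  have : IsHausdorff (IsLocalRing.maximalIdeal ℤ_[p]) (WittVector p L) := by
    rw [← IsHausdorff.map_algebraMap_iff (S := WittVector p L), hpI, Ideal.map_span,
      Set.image_singleton, map_natCast]
    infer_instance
  refine span_range_eq_top_of_mkQ (I := IsLocalRing.maximalIdeal ℤ_[p]) fun w =>
    ⟨fun i => ((b.repr (w.coeff 0) i).val : ℤ_[p]), ?_⟩
  rw [Ideal.smul_top_eq_map, Submodule.restrictScalars_mem, hpI, Ideal.map_span,
    Set.image_singleton, map_natCast, ← WittVector.ker_constantCoeff, RingHom.mem_ker, map_sub,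
    map_sum, sub_eq_zero]
  nth_rewrite 1 [WittVector.constantCoeff_apply, ← b.sum_repr (w.coeff 0)]
  refine Finset.sum_congr rfl fun i _ => ?_
  rw [Algebra.smul_def, Algebra.smul_def, map_mul, map_natCast, map_natCast,
    WittVector.constantCoeff_apply, WittVector.teichmuller_coeff_zero,
    ← map_natCast (algebraMap (ZMod p) L), ZMod.natCast_zmod_val]

theorem padicIntToWitt_wittTrace {r : ℕ} (hr : Nat.card L = p ^ r) (y : WittVector p L) :
    padicIntToWitt p (wittTrace p y) = ∑ j ∈ Finset.range r, frobPow p L j y := by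
  let _ : Algebra (ZMod p) L := ZMod.algebra L p
  have : FaithfulSMul ℤ_[p] (WittVector p L) :=
    (faithfulSMul_iff_algebraMap_injective _ _).2 (padicIntToWitt_injective p)
  have hrank : Module.finrank (ZMod p) L = r := Nat.pow_right_injective
    (Fact.out : p.Prime).two_le ((FiniteField.pow_finrank_eq_natCard p L).trans hr)
  let σ (j : Fin r) : WittVector p L →ₐ[ℤ_[p]] WittVector p L :=
    { frobPow p L j with commutes' := frobPow_padicIntToWitt p j }
  have hσ : Function.Injective σ := fun i j h =>
    frobPow_injective_of_card p hr (RingHom.ext fun w => DFunLike.congr_fun h w)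
  rw [Finset.sum_range]
  exact algebraMap_trace_eq_sum_algHom hσ
    (span_teichmuller_eq_top p (Module.finBasisOfFinrankEq (ZMod p) L hrank)) y

omit [Finite L] in
theorem wittTrace_add (x y : WittVector p L) :
    wittTrace p (x + y) = wittTrace p x + wittTrace p y :=
  map_add (Algebra.trace ℤ_[p] (WittVector p L)) x y

omit [Finite L] in
theorem wittTrace_p_pow_mul (n : ℕ) (y : WittVector p L) :
    wittTrace p ((p : WittVector p L) ^ n * y) = (p : ℤ_[p]) ^ n * wittTrace p y := by
  have hsmul : (p : WittVector p L) ^ n * y = (p : ℤ_[p]) ^ n • y := by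
    rw [Algebra.smul_def, map_pow, map_natCast]
  rw [hsmul]
  exact map_smul (Algebra.trace ℤ_[p] (WittVector p L)) _ y

end WittTrace

section RootsOfUnity

variable (p : ℕ) [Fact p.Prime] {L : Type*} [Field L]

theorem frobPow_eq_id [Finite L] [CharP L p] {r : ℕ} (hr : Nat.card L = p ^ r) :
    frobPow p L r = RingHom.id _ := by
  have : Fintype L := Fintype.ofFinite L
  ext w n
  rw [frobPow_apply, WittVector.iterate_frobenius_coeff, ← hr, Nat.card_eq_fintype_card,
    FiniteField.pow_card, RingHom.id_apply]

variable [Fintype Lˣ]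

theorem image_teichmuller_units [CharP L p] [DecidableEq (WittVector p L)] :
    Finset.univ.image (fun t : Lˣ => WittVector.teichmuller p (t : L)) =
      Polynomial.nthRootsFinset (Nat.card L - 1) (1 : WittVector p L) := by
  have hcard : Fintype.card Lˣ = Nat.card L - 1 := by
    rw [← Nat.card_eq_fintype_card, Nat.card_units]
  have hpos : 0 < Nat.card L - 1 := hcard ▸ Fintype.card_pos
  refine Finset.eq_of_subset_of_card_le (fun x hx => ?_) ?_
  · obtain ⟨t, -, rfl⟩ := Finset.mem_image.1 hx
    rw [Polynomial.mem_nthRootsFinset hpos, ← map_pow, ← Units.val_pow_eq_pow_val, ← hcard,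
      pow_card_eq_one, Units.val_one, map_one]
  · rw [Finset.card_image_of_injective _ fun _ _ h =>
        Units.val_injective (teichmuller_injective p h),
      Finset.card_univ, hcard, Polynomial.nthRootsFinset_def]
    exact (Multiset.toFinset_card_le _).trans (Polynomial.card_nthRoots _ _)

theorem sum_nthRootsFinset [CharP L p] {M : Type*} [AddCommMonoid M] (g : WittVector p L → M) :
    ∑ x ∈ Polynomial.nthRootsFinset (Nat.card L - 1) (1 : WittVector p L), g x =
      ∑ t : Lˣ, g (WittVector.teichmuller p (t : L)) := by
  classical
  rw [← image_teichmuller_units, Finset.sum_image fun x _ y _ h =>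
    Units.val_injective (teichmuller_injective p h)]

theorem sum_teichmuller_pow [Finite L] [CharP L p] (n : ℕ) :
    ∑ t : Lˣ, (WittVector.teichmuller p (t : L)) ^ n =
      if Nat.card L - 1 ∣ n then ((Nat.card L - 1 : ℕ) : WittVector p L) else 0 := by
  classical
  have : Fintype L := Fintype.ofFinite L
  let χ : Lˣ →* WittVector p L :=
    (powMonoidHom n).comp ((WittVector.teichmuller p).comp (Units.coeHom L))
  have hχ : ∀ t, χ t = (WittVector.teichmuller p (t : L)) ^ n := fun _ => rfl
  have htrivial : χ = 1 ↔ Nat.card L - 1 ∣ n := by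
    rw [Nat.card_eq_fintype_card, ← FiniteField.forall_pow_eq_one_iff, DFunLike.ext_iff]
    refine forall_congr' fun t => ?_
    rw [hχ, ← map_pow, MonoidHom.one_apply, ← map_one (WittVector.teichmuller p),
      (teichmuller_injective p).eq_iff, ← Units.val_pow_eq_pow_val, Units.val_eq_one]
  have hsum := sum_hom_units χ
  simp only [hχ, htrivial, ← Nat.card_eq_fintype_card, Nat.card_units] at hsum
  rw [hsum]
  split_ifs <;> simp only [Nat.cast_zero]

end RootsOfUnity

section FHat

theorem exists_hasSum_pow_mul {R : Type*} [CommRing R] (ϖ : R)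
    [IsPrecomplete (Ideal.span {ϖ}) R] (v : ℕ → R) :
    ∃ w, @HasSum _ _ _ (Ideal.span {ϖ}).adicTopology (fun i => ϖ ^ i * v i) w
      (SummationFilter.unconditional ℕ) ∧
        ∀ n, ϖ ^ n ∣ ∑ i ∈ Finset.range n, ϖ ^ i * v i - w := by
  have htail : ∀ (s t : Finset ℕ) (n : ℕ), s ⊆ t → Finset.range n ⊆ s →
      ϖ ^ n ∣ ∑ i ∈ t, ϖ ^ i * v i - ∑ i ∈ s, ϖ ^ i * v i := fun s t n hst hn => by
    rw [← Finset.sum_sdiff hst, add_sub_cancel_right]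
    refine Finset.dvd_sum fun i hi => (pow_dvd_pow _ ?_).mul_right _
    exact not_lt.1 fun hlt => (Finset.mem_sdiff.1 hi).2 (hn (Finset.mem_range.2 hlt))
  obtain ⟨w, hw⟩ := exists_forall_pow_dvd_sub (ϖ := ϖ)
    (x := fun n => ∑ i ∈ Finset.range n, ϖ ^ i * v i)
    fun m n hmn => htail _ _ m (Finset.range_subset_range.2 hmn) subset_rfl
  refine ⟨w, tendsto_adicTopology_span_singleton_iff.2 fun N =>
    Filter.eventually_atTop.2 ⟨Finset.range N, fun t ht => ?_⟩, hw⟩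
  simpa only [sub_add_sub_cancel] using dvd_add (htail _ t N ht subset_rfl) (hw N)

variable (p : ℕ) [Fact p.Prime] {K L : Type*} [Field K] [Field L] [CharP L p]
  [Algebra K L]

theorem p_pow_dvd_sum_sub_fHat [PerfectRing L p] (f : ℕ → Polynomial K) (x : WittVector p L)
    (n : ℕ) :
    (p : WittVector p L) ^ n ∣ ∑ i ∈ Finset.range n, (p : WittVector p L) ^ i *
      (teichPoly p (f i)).eval₂ (WittVector.map (algebraMap K L)) x - fHat p f x := by
  let : TopologicalSpace (WittVector p L) := wittTopology p L
  have : T2Space (WittVector p L) := t2Space_adicTopology _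
  obtain ⟨w, hsum, hw⟩ := exists_hasSum_pow_mul (p : WittVector p L) fun i =>
    (teichPoly p (f i)).eval₂ (WittVector.map (algebraMap K L)) x
  rw [show fHat p f x = w from hsum.tsum_eq]
  exact hw n

omit [CharP L p] in
theorem teichPoly_eval₂ (h : Polynomial K) (t : L) :
    (teichPoly p h).eval₂ (WittVector.map (algebraMap K L)) (WittVector.teichmuller p t) =
      ∑ u ∈ Finset.range (h.natDegree + 1),
        WittVector.teichmuller p (algebraMap K L (h.coeff u) * t ^ u) := by
  rw [teichPoly, Polynomial.sum_over_range _ (by simp), Polynomial.eval₂_finsetSum]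
  refine Finset.sum_congr rfl fun u _ => ?_
  rw [Polynomial.eval₂_monomial, WittVector.map_teichmuller, map_mul, map_pow]

end FHat

section LogDerivative

theorem derivation_prod_of_eq_mul {R A ι : Type*} [CommRing R] [CommRing A] [Algebra R A]
    (δ : Derivation R A A) (s : Finset ι) (f g : ι → A) (h : ∀ i ∈ s, δ (f i) = g i * f i) :
    δ (∏ i ∈ s, f i) = (∑ i ∈ s, g i) * ∏ i ∈ s, f i := by
  classical
  rw [derivation_prod, Finset.sum_mul]
  refine Finset.sum_congr rfl fun i hi => ?_
  rw [h i hi, ← Finset.mul_prod_erase s f hi]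
  ring

variable {A : Type*} [CommRing A]

theorem derivative_map {B : Type*} [CommRing B] (φ : A →+* B) (F : A⟦X⟧) :
    derivative B (PowerSeries.map φ F) = PowerSeries.map φ (derivative A F) := by
  ext n
  simp [coeff_derivative]

theorem coeff_succ_of_one_add_X_mul_derivative {w : A} {F : A⟦X⟧}
    (hF : (1 + X) * derivative A F = C w * F) (n : ℕ) :
    ((n : A) + 1) * coeff (n + 1) F = (w - n) * coeff n F := by
  have hcoeff := congrArg (coeff n) hF
  rw [add_mul, one_mul, map_add, coeff_derivative, coeff_C_mul] at hcoeff
  cases n with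
  | zero =>
    rw [coeff_zero_X_mul] at hcoeff
    push_cast at hcoeff ⊢
    linear_combination hcoeff
  | succ n =>
    rw [coeff_succ_X_mul, coeff_derivative] at hcoeff
    push_cast at hcoeff ⊢
    linear_combination hcoeff

theorem eq_of_one_add_X_mul_derivative [IsDomain A] [CharZero A] {w : A} {F G : A⟦X⟧}
    (hF : (1 + X) * derivative A F = C w * F) (hG : (1 + X) * derivative A G = C w * G)
    (hconst : constantCoeff F = constantCoeff G) : F = G := by
  ext n
  induction n with
  | zero => simpa only [coeff_zero_eq_constantCoeff_apply] using hconst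
  | succ n ih =>
    refine mul_left_cancel₀ (Nat.cast_add_one_ne_zero n : (n : A) + 1 ≠ 0) ?_
    rw [coeff_succ_of_one_add_X_mul_derivative hF, coeff_succ_of_one_add_X_mul_derivative hG, ih]

theorem succ_mul_choose_succ {R : Type*} [CommRing R] [BinomialRing R] (w : R) (n : ℕ) :
    Ring.choose w (n + 1) * ((n : R) + 1) = (w - n) * Ring.choose w n := by
  have hchoose := Ring.choose_smul_choose w (Nat.le_succ n)
  rw [Nat.succ_eq_add_one, Nat.choose_succ_self_right, Nat.add_sub_cancel_left,
    Ring.choose_one_right, nsmul_eq_mul] at hchoose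
  push_cast at hchoose
  linear_combination hchoose

theorem one_add_X_mul_derivative_binomialSeries {R : Type*} [CommRing R] [BinomialRing R] (w : R) :
    (1 + X) * derivative R (binomialSeries R w) = C w * binomialSeries R w := by
  ext n
  rw [add_mul, one_mul, map_add, coeff_derivative, coeff_C_mul]
  simp only [binomialSeries_coeff, smul_eq_mul, mul_one, succ_mul_choose_succ]
  cases n with
  | zero => simp
  | succ n =>
    rw [coeff_succ_X_mul, coeff_derivative]
    simp only [binomialSeries_coeff, smul_eq_mul, mul_one, succ_mul_choose_succ]
    push_cast
    linear_combination -succ_mul_choose_succ w n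

end LogDerivative

section LogDerivSeries

variable (p : ℕ)

/-- The series `∑_i X ^ (p ^ i - 1)`, the logarithmic derivative of the Artin-Hasse series. The
exponents are encoded as the `n` for which `n + 1` is a power of `p`. -/
noncomputable def ahLogDeriv (A : Type*) [CommRing A] : A⟦X⟧ :=
  open scoped Classical in
  PowerSeries.mk fun n => if ∃ i : ℕ, n + 1 = p ^ i then 1 else 0

theorem map_ahLogDeriv {A B : Type*} [CommRing A] [CommRing B] (φ : A →+* B) :
    PowerSeries.map φ (ahLogDeriv p A) = ahLogDeriv p B := by
  ext n
  simp only [ahLogDeriv, coeff_map, coeff_mk]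
  split_ifs <;> simp only [map_one, map_zero]

variable {A : Type*} [CommRing A]

theorem sum_pow_pow_add {y : A} {r : ℕ} (hy : y ^ p ^ r = y) (i : ℕ) :
    ∑ j ∈ Finset.range r, y ^ p ^ (j + i) = ∑ j ∈ Finset.range r, y ^ p ^ j := by
  induction i with
  | zero => rfl
  | succ i ih =>
    have hperiod : y ^ p ^ (r + i) = y ^ p ^ (0 + i) := by
      rw [pow_add, pow_mul, hy, zero_add]
    have hshift := (Finset.sum_range_succ' (fun j => y ^ p ^ (j + i)) r).symm.trans
      (Finset.sum_range_succ (fun j => y ^ p ^ (j + i)) r)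
    rw [hperiod, ih] at hshift
    rw [← add_right_cancel hshift]
    exact Finset.sum_congr rfl fun j _ => by rw [add_right_comm, add_assoc]

theorem sum_C_mul_rescale_ahLogDeriv {y : A} {r : ℕ} (hy : y ^ p ^ r = y) :
    ∑ j ∈ Finset.range r, C (y ^ p ^ j) * rescale (y ^ p ^ j) (ahLogDeriv p A) =
      C (∑ j ∈ Finset.range r, y ^ p ^ j) * ahLogDeriv p A := by
  ext n
  simp only [map_sum (coeff n), coeff_C_mul, coeff_rescale, ahLogDeriv, coeff_mk]
  split_ifs with h
  · obtain ⟨i, hi⟩ := h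
    rw [mul_one, ← sum_pow_pow_add p hy i]
    refine Finset.sum_congr rfl fun j _ => ?_
    rw [mul_one, ← pow_succ', ← pow_mul, hi, ← pow_add]
  · simp only [mul_zero, Finset.sum_const_zero]

theorem rescale_subst (c : A) (F : A⟦X⟧) {Y : A⟦X⟧} (hY : HasSubst Y) :
    (rescale c F).subst Y = F.subst (C c * Y) := by
  rw [rescale_eq_subst, subst_comp_subst_apply (HasSubst.smul_X' c) hY]
  congr 1
  rw [smul_eq_C_mul, subst_mul hY, subst_X hY, subst_C]
  rfl

theorem subst_eq_C_add_mul (F : A⟦X⟧) {Y : A⟦X⟧} (hY : HasSubst Y) :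
    F.subst Y = C (constantCoeff F) + Y * (PowerSeries.mk fun n => coeff (n + 1) F).subst Y := by
  nth_rewrite 1 [eq_X_mul_shift_add_const F]
  rw [subst_add hY, subst_mul hY, subst_X hY, subst_C, add_comm]
  rfl

end LogDerivSeries

section ArtinHasse

variable (p : ℕ) [Fact p.Prime]

theorem map_artinHasse :
    PowerSeries.map PadicInt.Coe.ringHom (artinHasse p) = artinHasseQ p := by
  ext n
  rw [coeff_map, artinHasse, coeff_mk]
  rfl

theorem derivative_ahLog : derivative ℚ_[p] (ahLog p) = ahLogDeriv p ℚ_[p] := by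
  ext n
  rw [coeff_derivative, ahLog, ahLogDeriv, coeff_mk, coeff_mk]
  split_ifs
  · push_cast
    exact inv_mul_cancel₀ (Nat.cast_add_one_ne_zero n)
  · exact zero_mul _

theorem derivative_artinHasse :
    derivative ℤ_[p] (artinHasse p) = ahLogDeriv p ℤ_[p] * artinHasse p := by
  apply PowerSeries.map_injective (PadicInt.Coe.ringHom (p := p)) Subtype.val_injective
  rw [← derivative_map, map_mul, map_artinHasse, derivative_artinHasseQ, map_ahLogDeriv,
    derivative_ahLog]

theorem constantCoeff_artinHasse : constantCoeff (artinHasse p) = 1 := by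
  rw [← coeff_zero_eq_constantCoeff_apply, artinHasse, coeff_mk]
  exact Subtype.ext ((coeff_zero_eq_constantCoeff_apply _).trans (artinHasseQ_zero p))

theorem constantCoeff_one_add_X_pow_sub_one {A : Type*} [CommRing A] (n : ℕ) :
    constantCoeff ((1 + X) ^ n - 1 : A⟦X⟧) = 0 := by
  simp

theorem constantCoeff_piSeries (i : ℕ) : constantCoeff (piSeries p i) = 0 :=
  constantCoeff_subst_eq_zero (constantCoeff_one_add_X_pow_sub_one _) _
    (constantCoeff_substInvOfIsUnit _ _)

theorem artinHasse_subst_piSeries (i : ℕ) :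
    (artinHasse p).subst (piSeries p i) = (1 + X) ^ p ^ i := by
  have hY : HasSubst ((1 + X) ^ p ^ i - 1 : ℤ_[p]⟦X⟧) :=
    HasSubst.of_constantCoeff_zero' (constantCoeff_one_add_X_pow_sub_one _)
  have hπ : HasSubst (piSeries p i) :=
    HasSubst.of_constantCoeff_zero' (constantCoeff_piSeries p i)
  have hconst : constantCoeff (artinHasse p - 1) = 0 := by
    rw [map_sub, constantCoeff_artinHasse, map_one, sub_self]
  have hinv : (artinHasse p - 1).subst (piSeries p i) = ((1 + X) ^ p ^ i - 1 : ℤ_[p]⟦X⟧) := by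
    rw [piSeries, ← subst_comp_subst_apply (HasSubst.substInvOfIsUnit _ _) hY,
      subst_substInvOfIsUnit_right _ hconst, subst_X hY]
  rw [← coe_substAlgHom hπ, map_sub, map_one, coe_substAlgHom] at hinv
  exact sub_left_injective hinv

variable {A : Type*} [CommRing A] (φ : ℤ_[p] →+* A)

theorem derivative_artinHasse_subst {Y : A⟦X⟧} (hY : HasSubst Y) :
    derivative A ((PowerSeries.map φ (artinHasse p)).subst Y) =
      (ahLogDeriv p A).subst Y * derivative A Y * (PowerSeries.map φ (artinHasse p)).subst Y := by
  rw [derivative_subst hY, derivative_map, derivative_artinHasse, map_mul, map_ahLogDeriv,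
    subst_mul hY]
  ring

theorem constantCoeff_map_artinHasse_subst {Y : A⟦X⟧} (hY : constantCoeff Y = 0) :
    constantCoeff ((PowerSeries.map φ (artinHasse p)).subst Y) = 1 := by
  rw [subst_eq_C_add_mul _ (HasSubst.of_constantCoeff_zero' hY), map_add, map_mul, hY, zero_mul,
    add_zero, constantCoeff_C, ← coeff_zero_eq_constantCoeff_apply, coeff_map,
    coeff_zero_eq_constantCoeff_apply, constantCoeff_artinHasse, map_one]

theorem one_add_X_mul_ahLogDeriv_subst_mul_derivative [IsDomain A] {P : A⟦X⟧}
    (hP : constantCoeff P = 0) {n : ℕ}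
    (hE : (PowerSeries.map φ (artinHasse p)).subst P = (1 + X) ^ n) :
    (1 + X) * ((ahLogDeriv p A).subst P * derivative A P) = (n : A⟦X⟧) := by
  have hne : (1 + X : A⟦X⟧) ≠ 0 := fun h => by
    simpa using congrArg (constantCoeff (R := A)) h
  have hderiv := derivative_artinHasse_subst p φ (HasSubst.of_constantCoeff_zero' hP)
  rw [hE, Derivation.leibniz_pow, map_add, Derivation.map_one_eq_zero, derivative_X, zero_add,
    nsmul_eq_mul, smul_eq_mul, mul_one] at hderiv
  refine mul_right_cancel₀ (pow_ne_zero n hne) ?_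
  rw [mul_assoc, ← hderiv]
  cases n with
  | zero => simp
  | succ n => rw [Nat.add_sub_cancel]; ring

omit [Fact p.Prime] in
theorem sum_C_mul_rescale_ahLogDeriv_subst {y : A} {r : ℕ} (hy : y ^ p ^ r = y) {P : A⟦X⟧}
    (hP : HasSubst P) :
    ∑ j ∈ Finset.range r, C (y ^ p ^ j) * (rescale (y ^ p ^ j) (ahLogDeriv p A)).subst P =
      C (∑ j ∈ Finset.range r, y ^ p ^ j) * (ahLogDeriv p A).subst P := by
  have hsubst := congrArg (substAlgHom hP) (sum_C_mul_rescale_ahLogDeriv p hy)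
  rw [map_sum, map_mul] at hsubst
  simp only [map_mul, coe_substAlgHom, subst_C] at hsubst
  exact hsubst

theorem derivative_artinHasse_subst_C_mul {P : A⟦X⟧} (hP : constantCoeff P = 0) (c : A) :
    derivative A ((PowerSeries.map φ (artinHasse p)).subst (C c * P)) =
      C c * (rescale c (ahLogDeriv p A)).subst P * derivative A P *
        (PowerSeries.map φ (artinHasse p)).subst (C c * P) := by
  have hcP : constantCoeff (C c * P) = 0 := by rw [map_mul, hP, mul_zero]
  rw [derivative_artinHasse_subst p φ (HasSubst.of_constantCoeff_zero' hcP),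
    ← rescale_subst _ _ (HasSubst.of_constantCoeff_zero' hP), Derivation.leibniz, derivative_C,
    smul_zero, add_zero, smul_eq_mul]
  ring

/-- Both sides satisfy `(1 + X) F' = n φ(z) F`. -/
theorem prod_artinHasse_subst [IsDomain A] [CharZero A] {y : A} {r : ℕ} (hy : y ^ p ^ r = y)
    {P : A⟦X⟧} (hP : constantCoeff P = 0) {n : ℕ}
    (hE : (PowerSeries.map φ (artinHasse p)).subst P = (1 + X) ^ n) {z : ℤ_[p]}
    (hz : φ z = ∑ j ∈ Finset.range r, y ^ p ^ j) :
    ∏ j ∈ Finset.range r, (PowerSeries.map φ (artinHasse p)).subst (C (y ^ p ^ j) * P) =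
      PowerSeries.map φ (binomialSeries ℤ_[p] (n * z)) := by
  refine eq_of_one_add_X_mul_derivative (w := φ (n * z)) ?_ ?_ ?_
  · rw [derivation_prod_of_eq_mul _ _ _ _ fun j _ =>
        derivative_artinHasse_subst_C_mul p φ hP (y ^ p ^ j),
      ← Finset.sum_mul,
      sum_C_mul_rescale_ahLogDeriv_subst p hy (HasSubst.of_constantCoeff_zero' hP),
      ← hz, map_mul, map_natCast, map_mul, map_natCast,
      ← one_add_X_mul_ahLogDeriv_subst_mul_derivative p φ hP hE]
    ring
  · rw [derivative_map, ← map_X φ, ← map_one (PowerSeries.map φ), ← map_add, ← map_mul,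
      one_add_X_mul_derivative_binomialSeries, map_mul, map_C]
  · rw [map_prod, Finset.prod_eq_one fun j _ => constantCoeff_map_artinHasse_subst p φ
        (by rw [map_mul, hP, mul_zero]), ← coeff_zero_eq_constantCoeff_apply, coeff_map,
      binomialSeries_coeff, Ring.choose_zero_right, one_smul, map_one]

end ArtinHasse

section Congruence

variable (p : ℕ)

/-- The ideal of the power series whose first `N` coefficients are divisible by `p ^ N`. For
varying `N` these ideals define the topology of coefficientwise `p`-adic convergence. -/
def smallIdeal (N : ℕ) (A : Type*) [CommRing A] : Ideal A⟦X⟧ where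
  carrier := {F | ∀ m < N, (p : A) ^ N ∣ coeff m F}
  add_mem' hF hG m hm := by
    rw [map_add]
    exact dvd_add (hF m hm) (hG m hm)
  zero_mem' m _ := by
    rw [map_zero]
    exact dvd_zero _
  smul_mem' F G hG m hm := by
    rw [smul_eq_mul, coeff_mul]
    refine Finset.dvd_sum fun x hx => (hG x.2 ?_).mul_left _
    exact (Finset.HasAntidiagonal.antidiagonal.snd_le hx).trans_lt hm

variable {A B : Type*} [CommRing A] [CommRing B]

variable {p}

theorem map_mem_smallIdeal (φ : A →+* B) {N : ℕ} {F : A⟦X⟧} (hF : F ∈ smallIdeal p N A) :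
    PowerSeries.map φ F ∈ smallIdeal p N B := fun m hm => by
  have hdvd := map_dvd φ (hF m hm)
  rwa [map_pow, map_natCast] at hdvd

theorem subst_sub_C_mem_smallIdeal (F : A⟦X⟧) {Y : A⟦X⟧} (hY : HasSubst Y) {N : ℕ}
    (h : Y ∈ smallIdeal p N A) : F.subst Y - C (constantCoeff F) ∈ smallIdeal p N A := by
  rw [subst_eq_C_add_mul F hY, add_sub_cancel_left]
  exact Ideal.mul_mem_right _ _ h

theorem prod_sub_prod_mem {ι : Type*} (I : Ideal A) (s : Finset ι) (f g : ι → A)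
    (h : ∀ i ∈ s, f i - g i ∈ I) : ∏ i ∈ s, f i - ∏ i ∈ s, g i ∈ I := by
  rw [← Ideal.Quotient.mk_eq_mk_iff_sub_mem, map_prod, map_prod]
  exact Finset.prod_congr rfl fun i hi => (Ideal.Quotient.mk_eq_mk_iff_sub_mem _ _).2 (h i hi)

theorem prod_sub_one_mem {ι : Type*} (I : Ideal A) (s : Finset ι) (f : ι → A)
    (h : ∀ i ∈ s, f i - 1 ∈ I) : ∏ i ∈ s, f i - 1 ∈ I := by
  simpa only [Finset.prod_const_one] using prod_sub_prod_mem I s f (fun _ => 1) h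

variable (p) [Fact p.Prime]

theorem isUnit_natCast_of_not_dvd {m : ℕ} (hm : ¬p ∣ m) : IsUnit (m : ℤ_[p]) := by
  rw [← not_not (a := IsUnit _), PadicInt.not_isUnit_iff, ← Int.cast_natCast,
    PadicInt.norm_intCast_lt_one_iff]
  exact_mod_cast hm

theorem natCast_dvd_p_pow {m : ℕ} (hm : m ≠ 0) : (m : ℤ_[p]) ∣ (p : ℤ_[p]) ^ m := by
  obtain ⟨v, m', hm', rfl⟩ :=
    Nat.exists_eq_pow_mul_and_not_dvd hm p (Fact.out : p.Prime).ne_one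
  have hv : v ≤ p ^ v * m' := (Nat.lt_pow_self (Fact.out : p.Prime).one_lt).le.trans
    (Nat.le_mul_of_pos_right _ (Nat.pos_of_ne_zero fun h => hm' (h ▸ dvd_zero p)))
  rw [Nat.cast_mul, Nat.cast_pow, (isUnit_natCast_of_not_dvd p hm').mul_right_dvd]
  exact pow_dvd_pow _ hv

/-- `m * choose w m = w * choose (w - 1) (m - 1)`, and `m` divides `p ^ m`. -/
theorem p_pow_dvd_choose {N m : ℕ} (hm : m ≠ 0) {w : ℤ_[p]} (hw : (p : ℤ_[p]) ^ (N + m) ∣ w) :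
    (p : ℤ_[p]) ^ N ∣ Ring.choose w m := by
  have hchoose := Ring.choose_smul_choose w (Nat.one_le_iff_ne_zero.2 hm)
  rw [Nat.choose_one_right, Ring.choose_one_right, nsmul_eq_mul] at hchoose
  refine (mul_dvd_mul_iff_left (Nat.cast_ne_zero.2 hm : (m : ℤ_[p]) ≠ 0)).1 ?_
  rw [hchoose, mul_comm]
  rw [pow_add] at hw
  exact ((mul_dvd_mul_left _ (natCast_dvd_p_pow p hm)).trans hw).mul_right _

theorem binomialSeries_sub_one_mem_smallIdeal {N : ℕ} {w : ℤ_[p]}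
    (hw : (p : ℤ_[p]) ^ (N + N) ∣ w) : binomialSeries ℤ_[p] w - 1 ∈ smallIdeal p N ℤ_[p] := by
  intro m hm
  rw [map_sub, binomialSeries_coeff, smul_eq_mul, mul_one, coeff_one]
  rcases eq_or_ne m 0 with rfl | hm_ne
  · rw [if_pos rfl, Ring.choose_zero_right, sub_self]
    exact dvd_zero _
  · rw [if_neg hm_ne, sub_zero]
    exact p_pow_dvd_choose p hm_ne ((pow_dvd_pow _ (Nat.add_le_add_left hm.le N)).trans hw)

theorem piSeries_mem_smallIdeal {N i : ℕ} (hi : N + N ≤ i) :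
    piSeries p i ∈ smallIdeal p N ℤ_[p] := by
  have hY : HasSubst ((1 + X) ^ p ^ i - 1 : ℤ_[p]⟦X⟧) :=
    HasSubst.of_constantCoeff_zero' (constantCoeff_one_add_X_pow_sub_one _)
  have hYmem : ((1 + X) ^ p ^ i - 1 : ℤ_[p]⟦X⟧) ∈ smallIdeal p N ℤ_[p] := by
    rw [← binomialSeries_nat (R := ℤ_[p])]
    refine binomialSeries_sub_one_mem_smallIdeal p ?_
    rw [Nat.cast_pow]
    exact pow_dvd_pow _ hi
  have hsubst := subst_sub_C_mem_smallIdeal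
    (substInvOfIsUnit (artinHasse p - 1) (isUnit_coeff_one_artinHasse p)) hY hYmem
  rwa [constantCoeff_substInvOfIsUnit, map_zero, sub_zero] at hsubst

end Congruence

section Swap

variable {R : Type*} [CommRing R]

/-- The embedding of `R[x]⟦T⟧` into `R⟦T⟧⟦x⟧` that interchanges the two indices of the
coefficients. Series in its image may be evaluated at elements of `R`-algebras. -/
noncomputable def swap (R : Type*) [CommRing R] : (Polynomial R)⟦X⟧ →+* R⟦X⟧⟦X⟧ where
  toFun F := PowerSeries.mk fun n => PowerSeries.mk fun m => (coeff m F).coeff n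
  map_zero' := by ext; simp
  map_add' F G := by ext; simp
  map_one' := by
    ext n m
    rw [coeff_mk, coeff_mk, coeff_one, coeff_one]
    split_ifs with hm hn hn <;> simp [hm, hn, coeff_one, Polynomial.coeff_one]
  map_mul' F G := by
    ext n m
    simp only [coeff_mk, coeff_mul, map_sum, Polynomial.finsetSum_coeff, Polynomial.coeff_mul]
    rw [Finset.sum_comm]

theorem coeff_coeff_swap (F : (Polynomial R)⟦X⟧) (n m : ℕ) :
    coeff m (coeff n (swap R F)) = (coeff m F).coeff n := by
  change coeff m (coeff n (PowerSeries.mk fun n => PowerSeries.mk fun m => (coeff m F).coeff n)) = _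
  rw [coeff_mk, coeff_mk]

theorem swap_C_monomial (u : ℕ) (c : R) :
    swap R (C (Polynomial.monomial u c)) = C (C c) * X ^ u := by
  ext n m
  rw [coeff_coeff_swap, coeff_C, coeff_C_mul, coeff_X_pow]
  split_ifs with hm hn hn
  · simp [hm, hn]
  · simp [Polynomial.coeff_monomial, Ne.symm hn]
  · simp [coeff_C, hm]
  · simp

theorem swap_map_C (η : R⟦X⟧) : swap R (PowerSeries.map Polynomial.C η) = C η := by
  ext n m
  rw [coeff_coeff_swap, coeff_map, Polynomial.coeff_C, coeff_C]
  split_ifs <;> rfl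

/-- The condition that the coefficient of `T ^ m` be a polynomial of degree at most `d m`, for
all `m`. It is what makes the Dwork matrix decay. -/
def HasWeight (d : ℕ) (F : (Polynomial R)⟦X⟧) : Prop :=
  ∀ m, (coeff m F).natDegree ≤ d * m

theorem hasWeight_one (d : ℕ) : HasWeight d (1 : (Polynomial R)⟦X⟧) := fun m => by
  rw [coeff_one]
  split_ifs <;> simp

theorem HasWeight.mul {d : ℕ} {F G : (Polynomial R)⟦X⟧} (hF : HasWeight d F) (hG : HasWeight d G) :
    HasWeight d (F * G) := fun m => by
  rw [coeff_mul]
  refine Polynomial.natDegree_sum_le_of_forall_le _ _ fun x hx => ?_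
  rw [← Finset.HasAntidiagonal.mem_antidiagonal.1 hx, mul_add]
  exact Polynomial.natDegree_mul_le.trans (add_le_add (hF _) (hG _))

theorem hasWeight_prod {ι : Type*} {d : ℕ} (s : Finset ι) (F : ι → (Polynomial R)⟦X⟧)
    (h : ∀ i ∈ s, HasWeight d (F i)) : HasWeight d (∏ i ∈ s, F i) :=
  Finset.prod_induction F (HasWeight d) (fun _ _ => HasWeight.mul) (hasWeight_one d) h

theorem coeff_pow_of_lt {Y : R⟦X⟧} (hY : constantCoeff Y = 0) {m n : ℕ} (h : m < n) :
    coeff m (Y ^ n) = 0 :=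
  X_pow_dvd_iff.1 (pow_dvd_pow_of_dvd (X_dvd_iff.2 hY) n) m h

theorem coeff_subst_eq_sum_range (F : R⟦X⟧) {Y : R⟦X⟧} (hY : constantCoeff Y = 0) (m : ℕ) :
    coeff m (F.subst Y) = ∑ n ∈ Finset.range (m + 1), coeff n F * coeff m (Y ^ n) := by
  rw [coeff_subst' (HasSubst.of_constantCoeff_zero' hY)]
  refine finsum_eq_sum_of_support_subset _ fun n => Function.mtr fun hn => ?_
  rw [Finset.mem_coe, Finset.mem_range, not_lt, Nat.succ_le_iff] at hn
  rw [Function.notMem_support, coeff_pow_of_lt hY hn, smul_zero]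

theorem hasWeight_subst (F η : R⟦X⟧) (hη : constantCoeff η = 0) {u d : ℕ} (hu : u ≤ d) (c : R) :
    HasWeight d ((PowerSeries.map Polynomial.C F).subst
      (C (Polynomial.monomial u c) * PowerSeries.map Polynomial.C η)) := fun m => by
  rw [coeff_subst_eq_sum_range _ (by
    rw [map_mul, ← coeff_zero_eq_constantCoeff_apply (PowerSeries.map _ η), coeff_map,
      coeff_zero_eq_constantCoeff_apply, hη, map_zero, mul_zero])]
  refine Polynomial.natDegree_sum_le_of_forall_le _ _ fun n hn => ?_
  rw [coeff_map, mul_pow, ← map_pow C, ← map_pow (PowerSeries.map _), coeff_C_mul, coeff_map]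
  calc (Polynomial.C (coeff n F) *
        (Polynomial.monomial u c ^ n * Polynomial.C (coeff m (η ^ n)))).natDegree
      ≤ (Polynomial.monomial u c ^ n).natDegree :=
        (Polynomial.natDegree_C_mul_le _ _).trans (Polynomial.natDegree_mul_C_le _ _)
    _ ≤ n * (Polynomial.monomial u c).natDegree := Polynomial.natDegree_pow_le
    _ ≤ m * d := Nat.mul_le_mul (Nat.lt_succ_iff.1 (Finset.mem_range.1 hn))
        ((Polynomial.natDegree_monomial_le _).trans hu)
    _ = d * m := mul_comm _ _

end Swap

section InfiniteProduct

variable {R : Type*} [CommRing R] {p : ℕ}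

theorem natCast_pow_dvd_iff_coeff {N : ℕ} {g : Polynomial R} :
    (p : Polynomial R) ^ N ∣ g ↔ ∀ c, (p : R) ^ N ∣ g.coeff c := by
  rw [← Polynomial.C_dvd_iff_dvd_coeff, map_pow, map_natCast]

theorem sub_mem_smallIdeal_iff {N : ℕ} {F G : (Polynomial R)⟦X⟧} :
    F - G ∈ smallIdeal p N (Polynomial R) ↔
      ∀ m < N, ∀ c, (p : R) ^ N ∣ (coeff m F).coeff c - (coeff m G).coeff c := by
  refine forall₂_congr fun m _ => ?_
  simp only [natCast_pow_dvd_iff_coeff, map_sub, Polynomial.coeff_sub]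

theorem exists_forall_sub_mem_smallIdeal [IsPrecomplete (Ideal.span {(p : R)}) R] {d : ℕ}
    {P : ℕ → (Polynomial R)⟦X⟧} (hw : ∀ n, HasWeight d (P n))
    (hP : ∀ m n, m ≤ n → P n - P m ∈ smallIdeal p m (Polynomial R)) :
    ∃ E : (Polynomial R)⟦X⟧, HasWeight d E ∧
      ∀ N, E - P N ∈ smallIdeal p N (Polynomial R) := by
  have hcoeff : ∀ m c N n, m < N → N ≤ n →
      (p : R) ^ N ∣ (coeff m (P n)).coeff c - (coeff m (P N)).coeff c :=
    fun m c N n hm hn => sub_mem_smallIdeal_iff.1 (hP N n hn) m hm c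
  have hlim : ∀ m c, ∃ l : R, ∀ n, (p : R) ^ n ∣ (coeff m (P (n + (m + 1)))).coeff c - l :=
    fun m c => exists_forall_pow_dvd_sub fun N n hn => (pow_dvd_pow _ (Nat.le_add_right _ _)).trans
      (hcoeff m c _ _ (by omega) (by omega))
  choose l hl using hlim
  refine ⟨PowerSeries.mk fun m => ∑ c ∈ Finset.range (d * m + 1), Polynomial.monomial c (l m c),
    fun m => ?_, fun N => sub_mem_smallIdeal_iff.2 fun m hm c => ?_⟩
  · rw [coeff_mk]
    refine Polynomial.natDegree_sum_le_of_forall_le _ _ fun c hc => ?_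
    exact (Polynomial.natDegree_monomial_le _).trans (Nat.lt_succ_iff.1 (Finset.mem_range.1 hc))
  · simp only [coeff_mk, Polynomial.finsetSum_coeff, Polynomial.coeff_monomial,
      Finset.sum_ite_eq', Finset.mem_range]
    split_ifs with hc
    · have hdvd := dvd_sub (hcoeff m c N _ hm (Nat.le_add_right N (m + 1))) (hl m c N)
      rwa [sub_sub_sub_cancel_left] at hdvd
    · rw [Polynomial.coeff_eq_zero_of_natDegree_lt ((hw N m).trans_lt (by omega)), sub_zero]
      exact dvd_zero _

/-- Convergence of the infinite product of the `F i` to `E` in `R[x]⟦T⟧`, coefficientwise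
`p`-adically and uniformly in the powers of `x`. -/
def IsProdLimit (p : ℕ) (F : ℕ → (Polynomial R)⟦X⟧) (E : (Polynomial R)⟦X⟧) : Prop :=
  ∀ N, ∀ᶠ s in Filter.atTop, E - ∏ i ∈ s, F i ∈ smallIdeal p N (Polynomial R)

theorem exists_isProdLimit [IsPrecomplete (Ideal.span {(p : R)}) R] {d : ℕ}
    (F : ℕ → (Polynomial R)⟦X⟧) (hw : ∀ i, HasWeight d (F i)) {I : ℕ → ℕ} (hI : Monotone I)
    (hF : ∀ N i, I N ≤ i → F i - 1 ∈ smallIdeal p N (Polynomial R)) :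
    ∃ E : (Polynomial R)⟦X⟧, HasWeight d E ∧ IsProdLimit p F E := by
  have htail : ∀ N s, Finset.range (I N) ⊆ s →
      ∏ i ∈ s, F i - ∏ i ∈ Finset.range (I N), F i ∈ smallIdeal p N (Polynomial R) := by
    intro N s hs
    rw [← Finset.prod_sdiff hs, ← sub_one_mul]
    refine Ideal.mul_mem_right _ _ (prod_sub_one_mem _ _ _ fun i hi => hF N i ?_)
    exact not_lt.1 fun hlt => (Finset.mem_sdiff.1 hi).2 (Finset.mem_range.2 hlt)
  obtain ⟨E, hE, hlim⟩ := exists_forall_sub_mem_smallIdeal (p := p)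
    (P := fun n => ∏ i ∈ Finset.range (I n), F i) (fun n => hasWeight_prod _ _ fun i _ => hw i)
    fun m n hmn => htail m _ (Finset.range_subset_range.2 (hI hmn))
  refine ⟨E, hE, fun N => Filter.eventually_atTop.2 ⟨Finset.range (I N), fun s hs => ?_⟩⟩
  simpa only [sub_sub_sub_cancel_right] using sub_mem (hlim N) (htail N s hs)

end InfiniteProduct

section Splitting

theorem constantCoeff_map_of_eq_zero {A B : Type*} [CommRing A] [CommRing B] (φ : A →+* B)
    {η : A⟦X⟧} (hη : constantCoeff η = 0) : constantCoeff (PowerSeries.map φ η) = 0 := by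
  rw [← coeff_zero_eq_constantCoeff_apply, coeff_map, coeff_zero_eq_constantCoeff_apply, hη,
    map_zero]

theorem constantCoeff_mul_map_of_eq_zero {A B : Type*} [CommRing A] [CommRing B] (φ : A →+* B)
    {η : A⟦X⟧} (hη : constantCoeff η = 0) (F : B⟦X⟧) :
    constantCoeff (F * PowerSeries.map φ η) = 0 := by
  rw [map_mul, constantCoeff_map_of_eq_zero φ hη, mul_zero]

variable (p : ℕ) [Fact p.Prime] {K : Type*} [Field K] [CharP K p]

open scoped PowerSeries.WithPiTopology

/-- The canonical map `ℤ_p → W(K)[x]`. -/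
noncomputable def padicIntToPoly (K : Type*) [Field K] [CharP K p] :
    ℤ_[p] →+* Polynomial (WittVector p K) :=
  Polynomial.C.comp (padicIntToWitt p)

/-- The value `E(η c x ^ u)` in `W(K)[x]⟦T⟧`. -/
noncomputable def polyFactor (η : ℤ_[p]⟦X⟧) (c : WittVector p K) (u : ℕ) :
    (Polynomial (WittVector p K))⟦X⟧ :=
  (PowerSeries.map (padicIntToPoly p K) (artinHasse p)).subst
    (C (Polynomial.monomial u c) * PowerSeries.map (padicIntToPoly p K) η)

/-- The factor `E_{f_i}(x, π_i)` of the splitting series, as an element of `W(K)[x]⟦T⟧`. -/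
noncomputable def polySplitFactor (f : ℕ → Polynomial K) (i : ℕ) :
    (Polynomial (WittVector p K))⟦X⟧ :=
  ∏ u ∈ Finset.range ((f i).natDegree + 1),
    polyFactor p (piSeries p i) (WittVector.teichmuller p ((f i).coeff u)) u

theorem map_padicIntToPoly (η : ℤ_[p]⟦X⟧) : PowerSeries.map (padicIntToPoly p K) η =
    PowerSeries.map Polynomial.C (PowerSeries.map (padicIntToWitt p) η) := by
  rw [padicIntToPoly, PowerSeries.map_comp, RingHom.comp_apply]

theorem artinHasseEval_swap [PerfectRing K p] {Y : (Polynomial (WittVector p K))⟦X⟧}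
    (hY : constantCoeff Y = 0) : artinHasseEval p (swap _ Y) =
      swap _ ((PowerSeries.map (padicIntToPoly p K) (artinHasse p)).subst Y) := by
  let : TopologicalSpace (WittVector p K) := wittTopology p K
  have : T2Space (WittVector p K) := t2Space_adicTopology _
  refine HasSum.tsum_eq ((WithPiTopology.hasSum_iff_hasSum_coeff _).2 fun N =>
    (WithPiTopology.hasSum_iff_hasSum_coeff _).2 fun m => ?_)
  have hterm (n : ℕ) :
      coeff m (coeff N (C (C (padicIntToWitt p (coeff n (artinHasse p)))) * swap _ Y ^ n)) =
        (coeff n (PowerSeries.map (padicIntToPoly p K) (artinHasse p)) *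
          coeff m (Y ^ n)).coeff N := by
    rw [← map_pow, coeff_C_mul, coeff_C_mul, coeff_coeff_swap, coeff_map, padicIntToPoly,
      RingHom.comp_apply, Polynomial.coeff_C_mul]
  simp only [hterm]
  rw [coeff_coeff_swap, coeff_subst_eq_sum_range _ hY, Polynomial.finsetSum_coeff]
  refine hasSum_sum_of_ne_finset_zero fun n hn => ?_
  rw [coeff_pow_of_lt hY (by simpa using hn), mul_zero, Polynomial.coeff_zero]

theorem splitFactor_eq_swap [PerfectRing K p] (h : Polynomial K) {η : ℤ_[p]⟦X⟧}
    (hη : constantCoeff η = 0) : splitFactor p h η =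
      swap _ (∏ u ∈ Finset.range (h.natDegree + 1),
        polyFactor p η (WittVector.teichmuller p (h.coeff u)) u) := by
  rw [splitFactor, map_prod]
  refine Finset.prod_congr rfl fun u _ => ?_
  rw [polyFactor, ← artinHasseEval_swap p (constantCoeff_mul_map_of_eq_zero _ hη _),
    map_mul (swap _), swap_C_monomial, map_padicIntToPoly, swap_map_C]
  congr 1
  rw [map_mul]
  ring

theorem hasWeight_polyFactor {η : ℤ_[p]⟦X⟧} (hη : constantCoeff η = 0) (c : WittVector p K)
    {u d : ℕ} (hu : u ≤ d) : HasWeight d (polyFactor p η c u) := by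
  rw [polyFactor, map_padicIntToPoly, map_padicIntToPoly]
  exact hasWeight_subst _ _ (constantCoeff_map_of_eq_zero _ hη) hu c

theorem polyFactor_sub_one_mem {η : ℤ_[p]⟦X⟧} (hη : constantCoeff η = 0) {N : ℕ}
    (h : η ∈ smallIdeal p N ℤ_[p]) (c : WittVector p K) (u : ℕ) :
    polyFactor p η c u - 1 ∈ smallIdeal p N (Polynomial (WittVector p K)) := by
  have hsubst := subst_sub_C_mem_smallIdeal (p := p) (N := N)
    (PowerSeries.map (padicIntToPoly p K) (artinHasse p))
    (HasSubst.of_constantCoeff_zero' (constantCoeff_mul_map_of_eq_zero (padicIntToPoly p K) hη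
      (C (Polynomial.monomial u c)))) (Ideal.mul_mem_left _ _ (map_mem_smallIdeal _ h))
  rwa [← coeff_zero_eq_constantCoeff_apply, coeff_map, coeff_zero_eq_constantCoeff_apply,
    constantCoeff_artinHasse, map_one, map_one] at hsubst

theorem exists_isProdLimit_polySplitFactor [PerfectRing K p] (f : ℕ → Polynomial K) {d : ℕ}
    (hd : ∀ i, (f i).natDegree ≤ d) :
    ∃ E, HasWeight d E ∧ IsProdLimit p (polySplitFactor p f) E :=
  exists_isProdLimit (polySplitFactor p f)
    (fun i => hasWeight_prod _ _ fun _ hu => hasWeight_polyFactor p (constantCoeff_piSeries p i) _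
      ((Nat.lt_succ_iff.1 (Finset.mem_range.1 hu)).trans (hd i)))
    (fun _ _ h => Nat.add_le_add h h) fun _ i hi => prod_sub_one_mem _ _ _ fun _ _ =>
      polyFactor_sub_one_mem p (constantCoeff_piSeries p i) (piSeries_mem_smallIdeal p hi) _ _

variable {p}

omit [CharP K p] in
theorem IsProdLimit.hasProd_swap {F : ℕ → (Polynomial (WittVector p K))⟦X⟧}
    {E : (Polynomial (WittVector p K))⟦X⟧} (h : IsProdLimit p F E) :
    letI : TopologicalSpace (WittVector p K) := wittTopology p K
    HasProd (fun i => swap _ (F i)) (swap _ E) := by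
  let : TopologicalSpace (WittVector p K) := wittTopology p K
  simp only [HasProd, SummationFilter.unconditional_filter, ← map_prod]
  refine (WithPiTopology.tendsto_iff_coeff_tendsto _ _ _ _).2 fun c =>
    (WithPiTopology.tendsto_iff_coeff_tendsto _ _ _ _).2 fun m =>
      tendsto_adicTopology_span_singleton_iff.2 fun N => ?_
  filter_upwards [h (N + (m + 1))] with s hs
  rw [coeff_coeff_swap, coeff_coeff_swap, ← dvd_neg, neg_sub]
  exact (pow_dvd_pow _ (Nat.le_add_right _ _)).trans (sub_mem_smallIdeal_iff.1 hs m (by omega) c)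

theorem IsProdLimit.splitConverges_and_splitSeries_eq [PerfectRing K p] {f : ℕ → Polynomial K}
    {E : (Polynomial (WittVector p K))⟦X⟧} (h : IsProdLimit p (polySplitFactor p f) E) :
    SplitConverges p f ∧ splitSeries p f = swap _ E := by
  let : TopologicalSpace (WittVector p K) := wittTopology p K
  have : T2Space (WittVector p K) := t2Space_adicTopology _
  have hprod : HasProd (fun i => splitFactor p (f i) (piSeries p i)) (swap _ E) := by
    simp only [splitFactor_eq_swap p _ (constantCoeff_piSeries p _)]
    exact h.hasProd_swap
  exact ⟨hprod.multipliable, hprod.tprod_eq⟩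

end Splitting

section PhiP

theorem phiP_expand_mul {R : Type*} [CommRing R] {p : ℕ} (hp : p ≠ 0) (F G : R⟦X⟧) :
    phiP p (expand p hp F * G) = F * phiP p G := by
  ext u
  rw [phiP, coeff_mk, coeff_mul, coeff_mul]
  refine (Finset.sum_of_injOn (fun x => (p * x.1, p * x.2)) ?_ ?_ ?_ ?_).symm
  · rintro ⟨i, j⟩ - ⟨i', j'⟩ - h
    obtain ⟨hi, hj⟩ := Prod.mk.inj h
    exact Prod.ext (mul_left_cancel₀ hp hi) (mul_left_cancel₀ hp hj)
  · rintro ⟨i, j⟩ hij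
    rw [Finset.mem_coe, Finset.HasAntidiagonal.mem_antidiagonal] at hij ⊢
    rw [← mul_add, hij]
  · rintro ⟨i, j⟩ hij hnot
    rw [Finset.HasAntidiagonal.mem_antidiagonal] at hij
    rw [coeff_expand_of_not_dvd, zero_mul]
    rintro ⟨i, rfl⟩
    obtain ⟨j, rfl⟩ := (Nat.dvd_add_right (dvd_mul_right p i)).1 (hij ▸ dvd_mul_right p u)
    refine hnot ⟨(i, j), Finset.HasAntidiagonal.mem_antidiagonal.2 ?_, rfl⟩
    exact mul_left_cancel₀ hp ((mul_add p i j).trans hij)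
  · rintro ⟨i, j⟩ -
    rw [coeff_expand_mul, phiP, coeff_mk]

end PhiP

section DworkOperator

variable (p : ℕ) [Fact p.Prime] {K : Type*} [Field K]

/-- The endomorphism `∑ c_n x ^ n ↦ ∑ σ^j(c_n) x ^ (p ^ j n)` of `W(K)[x]`. -/
noncomputable def polyFrob (K : Type*) [Field K] (j : ℕ) :
    Polynomial (WittVector p K) →+* Polynomial (WittVector p K) :=
  ((Polynomial.expand (WittVector p K) (p ^ j)) : Polynomial (WittVector p K) →+* _).comp
    (Polynomial.mapRingHom (frobPow p K j))

theorem polyFrob_apply (j : ℕ) (g : Polynomial (WittVector p K)) :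
    polyFrob p K j g = Polynomial.expand _ (p ^ j) (g.map (frobPow p K j)) := rfl

theorem polyFrob_zero : polyFrob p K 0 = RingHom.id _ := by
  ext g
  · simp [polyFrob_apply, frobPow]
  · simp [polyFrob_apply]

theorem polyFrob_one_comp (j : ℕ) :
    (polyFrob p K 1).comp (polyFrob p K j) = polyFrob p K (j + 1) := by
  refine Polynomial.ringHom_ext (fun c => ?_) ?_
  · simp only [RingHom.comp_apply, polyFrob_apply, Polynomial.map_C, Polynomial.expand_C]
    rw [frobPow_succ_apply p j c, frobPow_apply p 1]
    rfl
  · simp only [RingHom.comp_apply, polyFrob_apply, Polynomial.map_X, Polynomial.expand_X,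
      map_pow]
    rw [← pow_mul, pow_one, ← pow_succ']

theorem swap_map_polyFrob_one (H : (Polynomial (WittVector p K))⟦X⟧) :
    swap _ (PowerSeries.map (polyFrob p K 1) H) = expand p (Fact.out : p.Prime).ne_zero
      (PowerSeries.map (PowerSeries.map WittVector.frobenius) (swap _ H)) := by
  ext n m : 2
  rw [coeff_coeff_swap, coeff_map, polyFrob_apply, pow_one,
    Polynomial.coeff_expand (Fact.out : p.Prime).pos, coeff_expand]
  split_ifs
  · rw [Polynomial.coeff_map, coeff_map, coeff_map, coeff_coeff_swap, frobPow_apply]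
    rfl
  · rw [map_zero]

/-- The product of the series `σ^j(E)(x ^ (p ^ j))` over `j < r`, by which the `r`-th iterate of
the Dwork operator multiplies before it extracts every `p ^ r`-th coefficient. -/
noncomputable def frobProd (E : (Polynomial (WittVector p K))⟦X⟧) (r : ℕ) :
    (Polynomial (WittVector p K))⟦X⟧ :=
  ∏ j ∈ Finset.range r, PowerSeries.map (polyFrob p K j) E

theorem frobProd_succ (E : (Polynomial (WittVector p K))⟦X⟧) (r : ℕ) :
    frobProd p E (r + 1) = PowerSeries.map (polyFrob p K 1) (frobProd p E r) * E := by
  rw [frobProd, Finset.prod_range_succ', frobProd, map_prod, polyFrob_zero, PowerSeries.map_id,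
    id_eq]
  congr 1
  refine Finset.prod_congr rfl fun j _ => ?_
  rw [← polyFrob_one_comp, PowerSeries.map_comp, RingHom.comp_apply]

theorem hasWeight_frobProd_succ {E : (Polynomial (WittVector p K))⟦X⟧} {d : ℕ}
    (hE : HasWeight d E) (r : ℕ) : HasWeight (d * p ^ r) (frobProd p E (r + 1)) := by
  refine hasWeight_prod _ _ fun j hj m => ?_
  rw [coeff_map, polyFrob_apply, Polynomial.natDegree_expand]
  calc _ ≤ d * m * p ^ j :=
        Nat.mul_le_mul_right _ (Polynomial.natDegree_map_le.trans (hE m))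
    _ ≤ d * m * p ^ r := Nat.mul_le_mul_left _ (Nat.pow_le_pow_right
        (Fact.out : p.Prime).pos (Nat.lt_succ_iff.1 (Finset.mem_range.1 hj)))
    _ = d * p ^ r * m := mul_right_comm _ _ _

variable [CharP K p] [PerfectRing K p]

theorem map_frobenius_dworkOp (f : ℕ → Polynomial K) (g : (WittVector p K)⟦X⟧⟦X⟧) :
    PowerSeries.map (PowerSeries.map WittVector.frobenius) (dworkOp p f g) =
      phiP p (splitSeries p f * g) := by
  ext u m : 2
  simp only [dworkOp, coeff_map]
  exact (WittVector.frobeniusEquiv p K).apply_symm_apply _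

theorem map_frobPow_coeff_dworkOp_iterate {f : ℕ → Polynomial K}
    {E : (Polynomial (WittVector p K))⟦X⟧} (hE : splitSeries p f = swap _ E) (r : ℕ)
    (g : (WittVector p K)⟦X⟧⟦X⟧) (u : ℕ) :
    PowerSeries.map (frobPow p K r) (coeff u ((dworkOp p f)^[r] g)) =
      coeff (p ^ r * u) (swap _ (frobProd p E r) * g) := by
  induction r generalizing g u with
  | zero =>
    rw [frobProd, Finset.prod_range_zero, map_one, one_mul, pow_zero, one_mul]
    ext m : 1
    simp [frobPow]
  | succ r ih =>
    have hsucc : PowerSeries.map (frobPow p K (r + 1)) (coeff u ((dworkOp p f)^[r + 1] g)) =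
        PowerSeries.map WittVector.frobenius
          (coeff (p ^ r * u) (swap _ (frobProd p E r) * dworkOp p f g)) := by
      rw [← ih, Function.iterate_succ_apply]
      ext m : 1
      simp only [coeff_map, frobPow_succ_apply]
    rw [hsucc, ← coeff_map, map_mul, map_frobenius_dworkOp,
      ← phiP_expand_mul (Fact.out : p.Prime).ne_zero, ← swap_map_polyFrob_one, hE,
      ← mul_assoc (swap _ _), ← map_mul, ← frobProd_succ, phiP, coeff_mk, ← mul_assoc, pow_succ']

end DworkOperator

section DworkMatrix

variable (p : ℕ) [Fact p.Prime] {K : Type*} [Field K] [Finite K] [CharP K p]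
  {a : ℕ} (hK : Nat.card K = p ^ a) {f : ℕ → Polynomial K}
  {E : (Polynomial (WittVector p K))⟦X⟧} (hE : splitSeries p f = swap _ E)

include hK

theorem frobPow_mul_eq_id (k : ℕ) : frobPow p K (a * k) = RingHom.id _ := by
  have hid := frobPow_eq_id p hK
  rw [frobPow] at hid ⊢
  rw [pow_mul, hid]
  exact one_pow k

include hE

theorem coeff_dworkOp_iterate (k : ℕ) (g : (WittVector p K)⟦X⟧⟦X⟧) (u : ℕ) :
    coeff u ((dworkOp p f)^[a * k] g) =
      coeff (p ^ (a * k) * u) (swap _ (frobProd p E (a * k)) * g) := by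
  rw [← map_frobPow_coeff_dworkOp_iterate p hE, frobPow_mul_eq_id p hK, PowerSeries.map_id,
    id_eq]

theorem dworkMatrix_apply (k u v : ℕ) : dworkMatrix p f (a * k) u v =
    if v ≤ p ^ (a * k) * u then
      coeff (p ^ (a * k) * u - v) (swap _ (frobProd p E (a * k))) else 0 := by
  rw [dworkMatrix, Matrix.of_apply, coeff_dworkOp_iterate p hK hE, coeff_mul_X_pow']

theorem dworkMatrix_card_apply (u v : ℕ) : dworkMatrix p f a u v =
    if v ≤ p ^ a * u then coeff (p ^ a * u - v) (swap _ (frobProd p E a)) else 0 := by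
  simpa only [mul_one] using dworkMatrix_apply p hK hE 1 u v

theorem isPowers_dworkMatrix : IsPowers (fun u => p ^ a * u + 1) (dworkMatrix p f a)
    (fun k => dworkMatrix p f (a * k)) where
  one := by simp only [mul_one]
  succ k u v := by
    have hiterate : dworkMatrix p f (a * (k + 1)) u v =
        coeff u ((dworkOp p f)^[a * 1] ((dworkOp p f)^[a * k] (X ^ v))) := by
      rw [← Function.iterate_add_apply, mul_one, mul_add, mul_one, add_comm]
      rfl
    rw [hiterate, coeff_dworkOp_iterate p hK hE, mul_comm (swap _ _), coeff_mul,
      Finset.Nat.sum_antidiagonal_eq_sum_range_succ_mk]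
    simp only [mul_one, Nat.succ_eq_add_one]
    refine Finset.sum_congr rfl fun w hw => ?_
    rw [dworkMatrix_card_apply p hK hE,
      if_pos (Nat.lt_succ_iff.1 (Finset.mem_range.1 hw)), mul_comm]
    rfl
  row u w h := by
    rw [dworkMatrix_card_apply p hK hE, if_neg (by omega)]

theorem decays_dworkMatrix (ha : a ≠ 0) {d : ℕ} (hd : HasWeight d E) :
    Decays d (dworkMatrix p f a) := by
  intro u v m hm
  obtain ⟨b, rfl⟩ := Nat.exists_eq_succ_of_ne_zero ha
  rw [dworkMatrix_card_apply p hK hE] at hm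
  split_ifs at hm with hv
  · have hp := (Fact.out : p.Prime)
    rw [coeff_coeff_swap] at hm
    have hdeg : p ^ (b + 1) * u - v ≤ d * p ^ b * m :=
      (Polynomial.le_natDegree_of_ne_zero hm).trans (hasWeight_frobProd_succ p hd b m)
    have hscaled : p ^ b * (p * u) ≤ p ^ b * (d * m + v) :=
      calc p ^ b * (p * u) = p ^ (b + 1) * u := by ring
        _ ≤ d * p ^ b * m + v := Nat.sub_le_iff_le_add.1 hdeg
        _ ≤ d * p ^ b * m + p ^ b * v :=
          Nat.add_le_add_left (Nat.le_mul_of_pos_left _ (pow_pos hp.pos b)) _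
        _ = p ^ b * (d * m + v) := by ring
    exact (Nat.mul_le_mul_right u hp.two_le).trans
      (Nat.le_of_mul_le_mul_left hscaled (pow_pos hp.pos b))
  · exact absurd (map_zero _) hm

end DworkMatrix

section Evaluation

variable (p : ℕ) [Fact p.Prime] {K L : Type*} [Field K] [CharP K p] [Field L] [CharP L p]
  [Algebra K L]

theorem charZero_wittVector (L : Type*) [Field L] [CharP L p] : CharZero (WittVector p L) :=
  charZero_of_injective_ringHom (padicIntToWitt_injective p (L := L))

/-- Evaluation of polynomials over `W(K)` at the Teichmüller representative of `t` in `L`. -/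
noncomputable def teichEval (K : Type*) [Field K] [Algebra K L] (t : L) :
    Polynomial (WittVector p K) →+* WittVector p L :=
  Polynomial.eval₂RingHom (WittVector.map (algebraMap K L)) (WittVector.teichmuller p t)

theorem frobPow_map (j : ℕ) (w : WittVector p K) :
    WittVector.map (algebraMap K L) (frobPow p K j w) =
      frobPow p L j (WittVector.map (algebraMap K L) w) := by
  induction j with
  | zero => simp [frobPow]
  | succ j ih =>
    rw [frobPow_succ_apply, frobPow_succ_apply, ← ih]
    ext n
    simp only [WittVector.map_coeff, WittVector.coeff_frobenius_charP, map_pow]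

theorem teichEval_polyFrob (t : L) (j : ℕ) :
    (teichEval p K t).comp (polyFrob p K j) = (frobPow p L j).comp (teichEval p K t) := by
  refine Polynomial.ringHom_ext (fun c => ?_) ?_
  · simp only [RingHom.comp_apply, polyFrob_apply, Polynomial.map_C, Polynomial.expand_C,
      teichEval, Polynomial.coe_eval₂RingHom, Polynomial.eval₂_C, frobPow_map]
  · simp only [RingHom.comp_apply, polyFrob_apply, Polynomial.map_X, Polynomial.expand_X,
      teichEval, Polynomial.coe_eval₂RingHom, Polynomial.eval₂_X, Polynomial.eval₂_X_pow,
      frobPow_teichmuller]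

theorem map_teichEval_frobProd (t : L) (E : (Polynomial (WittVector p K))⟦X⟧) (r : ℕ) :
    PowerSeries.map (teichEval p K t) (frobProd p E r) =
      ∏ j ∈ Finset.range r,
        PowerSeries.map (frobPow p L j) (PowerSeries.map (teichEval p K t) E) := by
  rw [frobProd, map_prod]
  refine Finset.prod_congr rfl fun j _ => ?_
  ext m : 1
  simp only [coeff_map]
  exact RingHom.congr_fun (teichEval_polyFrob p t j) _

theorem map_artinHasse_subst_map_piSeries {A : Type*} [CommRing A] (φ : ℤ_[p] →+* A) (i : ℕ) :
    (PowerSeries.map φ (artinHasse p)).subst (PowerSeries.map φ (piSeries p i)) =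
      (1 + X) ^ p ^ i := by
  have hπ : HasSubst (piSeries p i) :=
    HasSubst.of_constantCoeff_zero' (constantCoeff_piSeries p i)
  have hmap : PowerSeries.map φ ((artinHasse p).subst (piSeries p i)) = (1 + X) ^ p ^ i := by
    rw [artinHasse_subst_piSeries, map_pow, map_add, map_one, map_X]
  exact (map_subst (h := φ) hπ (artinHasse p)).symm.trans hmap

theorem map_teichEval_polyFactor {η : ℤ_[p]⟦X⟧} (hη : constantCoeff η = 0) (c : K) (u : ℕ)
    (t : L) (j : ℕ) :
    PowerSeries.map (frobPow p L j) (PowerSeries.map (teichEval p K t)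
      (polyFactor p η (WittVector.teichmuller p c) u)) =
      (PowerSeries.map (padicIntToWitt p : ℤ_[p] →+* WittVector p L) (artinHasse p)).subst
        (C (WittVector.teichmuller p (algebraMap K L c * t ^ u) ^ p ^ j) *
          PowerSeries.map (padicIntToWitt p) η) := by
  let ψ : Polynomial (WittVector p K) →+* WittVector p L := (frobPow p L j).comp (teichEval p K t)
  have hsubst : HasSubst (C (Polynomial.monomial u (WittVector.teichmuller p c)) *
      PowerSeries.map (padicIntToPoly p K) η) :=
    HasSubst.of_constantCoeff_zero' (constantCoeff_mul_map_of_eq_zero _ hη _)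
  have hψ (F : ℤ_[p]⟦X⟧) : PowerSeries.map ψ (PowerSeries.map (padicIntToPoly p K) F) =
      PowerSeries.map (padicIntToWitt p) F := by
    ext n : 1
    simp only [ψ, coeff_map, padicIntToPoly, RingHom.comp_apply, teichEval,
      Polynomial.coe_eval₂RingHom, Polynomial.eval₂_C, map_padicIntToWitt, frobPow_padicIntToWitt]
  have hmonomial : ψ (Polynomial.monomial u (WittVector.teichmuller p c)) =
      WittVector.teichmuller p (algebraMap K L c * t ^ u) ^ p ^ j := by
    simp only [ψ, RingHom.comp_apply, teichEval, Polynomial.coe_eval₂RingHom,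
      Polynomial.eval₂_monomial, WittVector.map_teichmuller, ← map_pow, ← map_mul,
      frobPow_teichmuller]
  rw [← RingHom.comp_apply (PowerSeries.map (frobPow p L j)), ← PowerSeries.map_comp, polyFactor]
  refine (map_subst (h := ψ) hsubst _).trans ?_
  rw [hψ]
  congr 1
  change PowerSeries.map ψ _ = _
  rw [map_mul, hψ, map_C, hmonomial]

theorem prod_binomialSeries {ι : Type*} (s : Finset ι) (w : ι → ℤ_[p]) :
    ∏ i ∈ s, binomialSeries ℤ_[p] (w i) = binomialSeries ℤ_[p] (∑ i ∈ s, w i) := by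
  classical
  induction s using Finset.induction_on with
  | empty => simp
  | insert a s ha ih => rw [Finset.prod_insert ha, Finset.sum_insert ha, ih, binomialSeries_add]

theorem wittTrace_sum {ι : Type*} (s : Finset ι) (w : ι → WittVector p L) :
    wittTrace p (∑ i ∈ s, w i) = ∑ i ∈ s, wittTrace p (w i) := by
  simp only [wittTrace, map_sum]

omit [Fact p.Prime] in
theorem eq_of_forall_sub_mem_smallIdeal {R : Type*} [CommRing R]
    [IsHausdorff (Ideal.span {(p : R)}) R] {F G : R⟦X⟧} (h : ∀ N, F - G ∈ smallIdeal p N R) :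
    F = G := by
  ext m : 1
  refine eq_of_forall_pow_dvd_sub (ϖ := (p : R)) fun N => ?_
  rw [← map_sub]
  exact (pow_dvd_pow _ (Nat.le_add_right N (m + 1))).trans (h (N + (m + 1)) m (by omega))

theorem binomialSeries_wittTrace_sub_mem_smallIdeal {N : ℕ} {x y : WittVector p L}
    (h : (p : WittVector p L) ^ (N + N) ∣ x - y) :
    binomialSeries ℤ_[p] (wittTrace p x) - binomialSeries ℤ_[p] (wittTrace p y) ∈
      smallIdeal p N ℤ_[p] := by
  obtain ⟨w, hw⟩ := h
  rw [eq_add_of_sub_eq' hw, wittTrace_add, binomialSeries_add, ← mul_sub_one, wittTrace_p_pow_mul]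
  exact Ideal.mul_mem_left _ _
    (binomialSeries_sub_one_mem_smallIdeal p (dvd_mul_right _ _))

variable [Finite L] {r : ℕ} (hr : Nat.card L = p ^ r)

include hr

theorem prod_frobPow_polyFactor (i : ℕ) (c : K) (u : ℕ) (t : L) :
    ∏ j ∈ Finset.range r, PowerSeries.map (frobPow p L j) (PowerSeries.map (teichEval p K t)
      (polyFactor p (piSeries p i) (WittVector.teichmuller p c) u)) =
      PowerSeries.map (padicIntToWitt p) (binomialSeries ℤ_[p] ((p : ℤ_[p]) ^ i *
        wittTrace p (WittVector.teichmuller p (algebraMap K L c * t ^ u)))) := by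
  have := charZero_wittVector p L
  have : Fintype L := Fintype.ofFinite L
  have hroot : WittVector.teichmuller p (algebraMap K L c * t ^ u) ^ p ^ r =
      WittVector.teichmuller p (algebraMap K L c * t ^ u) := by
    rw [← map_pow, ← hr, Nat.card_eq_fintype_card, FiniteField.pow_card]
  have htrace : padicIntToWitt p
      (wittTrace p (WittVector.teichmuller p (algebraMap K L c * t ^ u))) =
      ∑ j ∈ Finset.range r, WittVector.teichmuller p (algebraMap K L c * t ^ u) ^ p ^ j := by
    simp only [padicIntToWitt_wittTrace p hr, frobPow_teichmuller]
  simp only [map_teichEval_polyFactor p (constantCoeff_piSeries p i)]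
  rw [prod_artinHasse_subst p _ hroot (constantCoeff_map_of_eq_zero _ (constantCoeff_piSeries p i))
    (map_artinHasse_subst_map_piSeries p _ i) htrace, Nat.cast_pow]

theorem prod_frobPow_prod_polySplitFactor (f : ℕ → Polynomial K) (t : L) (n : ℕ) :
    ∏ j ∈ Finset.range r, PowerSeries.map (frobPow p L j) (PowerSeries.map (teichEval p K t)
      (∏ i ∈ Finset.range n, polySplitFactor p f i)) =
      PowerSeries.map (padicIntToWitt p) (binomialSeries ℤ_[p] (wittTrace p
        (∑ i ∈ Finset.range n, (p : WittVector p L) ^ i * (teichPoly p (f i)).eval₂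
          (WittVector.map (algebraMap K L)) (WittVector.teichmuller p t)))) := by
  simp only [polySplitFactor, map_prod]
  rw [Finset.prod_comm, wittTrace_sum, ← prod_binomialSeries, map_prod]
  refine Finset.prod_congr rfl fun i _ => ?_
  rw [Finset.prod_comm, wittTrace_p_pow_mul, teichPoly_eval₂, wittTrace_sum, Finset.mul_sum,
    ← prod_binomialSeries, map_prod]
  exact Finset.prod_congr rfl fun u _ => prod_frobPow_polyFactor p hr i _ u t

theorem map_teichEval_frobProd_eq {f : ℕ → Polynomial K} {E : (Polynomial (WittVector p K))⟦X⟧}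
    (hE : IsProdLimit p (polySplitFactor p f) E) (t : L) :
    PowerSeries.map (teichEval p K t) (frobProd p E r) =
      PowerSeries.map (padicIntToWitt p)
        (binomialSeries ℤ_[p] (wittTrace p (fHat p f (WittVector.teichmuller p t)))) := by
  refine eq_of_forall_sub_mem_smallIdeal p fun N => ?_
  obtain ⟨n, hn, hNn⟩ := ((Filter.tendsto_finset_range.eventually (hE N)).and
    (Filter.eventually_ge_atTop (N + N))).exists
  have hfactors := prod_sub_prod_mem (smallIdeal p N (WittVector p L)) (Finset.range r)
    (fun j => PowerSeries.map (frobPow p L j) (PowerSeries.map (teichEval p K t) E))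
    (fun j => PowerSeries.map (frobPow p L j) (PowerSeries.map (teichEval p K t)
      (∏ i ∈ Finset.range n, polySplitFactor p f i))) fun j _ => by
        rw [← map_sub, ← map_sub]
        exact map_mem_smallIdeal _ (map_mem_smallIdeal _ hn)
  rw [prod_frobPow_prod_polySplitFactor p hr] at hfactors
  have hexponents := map_mem_smallIdeal (padicIntToWitt p : ℤ_[p] →+* WittVector p L)
    (binomialSeries_wittTrace_sub_mem_smallIdeal p ((pow_dvd_pow _ hNn).trans
      (p_pow_dvd_sum_sub_fHat p f (WittVector.teichmuller p t) n)))
  rw [map_sub] at hexponents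
  rw [map_teichEval_frobProd]
  simpa only [sub_add_sub_cancel] using add_mem hfactors hexponents

end Evaluation

section TraceFormula

theorem sum_range_mul_ite_dvd {M : Type*} [AddCommMonoid M] {q : ℕ} (hq : 0 < q) (r : ℕ)
    (g : ℕ → M) : ∑ n ∈ Finset.range (q * r), (if q ∣ n then g n else 0) =
      ∑ u ∈ Finset.range r, g (q * u) := by
  refine (Finset.sum_of_injOn (fun u => q * u) ?_ ?_ ?_ ?_).symm
  · exact fun u _ v _ h => Nat.eq_of_mul_eq_mul_left hq h
  · exact fun u hu => by simpa [hq] using hu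
  · rintro n hn hnot
    rw [if_neg]
    rintro ⟨u, rfl⟩
    exact hnot ⟨u, by simpa [hq] using hn, rfl⟩
  · exact fun u _ => (if_pos (dvd_mul_right q u)).symm

variable (p : ℕ) [Fact p.Prime] {K : Type*} [Field K]

theorem sum_teichEval_units {L : Type*} [Field L] [Finite L] [Fintype Lˣ] [CharP L p]
    [Algebra K L] {g : Polynomial (WittVector p K)} {r : ℕ} (hg : g.natDegree < r) :
    ∑ t : Lˣ, teichEval p K (t : L) g = ((Nat.card L - 1 : ℕ) : WittVector p L) *
      ∑ u ∈ Finset.range r,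
        WittVector.map (algebraMap K L) (g.coeff ((Nat.card L - 1) * u)) := by
  have hcard : 0 < Nat.card L - 1 := Nat.sub_pos_of_lt Finite.one_lt_card
  have hdeg : g.natDegree < (Nat.card L - 1) * r := hg.trans_le (Nat.le_mul_of_pos_left r hcard)
  simp only [teichEval, Polynomial.coe_eval₂RingHom, Polynomial.eval₂_eq_sum_range' _ hdeg]
  rw [Finset.sum_comm]
  simp only [← Finset.mul_sum, sum_teichmuller_pow, mul_ite, mul_zero]
  rw [sum_range_mul_ite_dvd hcard, ← Finset.sum_mul, mul_comm]

variable [Finite K] {a : ℕ} (hK : Nat.card K = p ^ a)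

omit [Fact p.Prime] in
include hK in
theorem exponent_ne_zero : a ≠ 0 := by
  rintro rfl
  exact Finite.one_lt_card.ne' (hK.trans (pow_zero p))

variable [CharP K p] {f : ℕ → Polynomial K} {E : (Polynomial (WittVector p K))⟦X⟧}

include hK

theorem map_expSum (hE : IsProdLimit p (polySplitFactor p f) E) (k : ℕ)
    [Fintype (FiniteField.Extension K p (k + 1))ˣ] :
    PowerSeries.map (padicIntToWitt p) (expSum p f (k + 1)) =
      ∑ t : (FiniteField.Extension K p (k + 1))ˣ,
        PowerSeries.map (teichEval p K (t : FiniteField.Extension K p (k + 1)))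
          (frobProd p E (a * (k + 1))) := by
  have hcard : Nat.card (FiniteField.Extension K p (k + 1)) = Nat.card K ^ (k + 1) :=
    FiniteField.natCard_extension K p (k + 1)
  have hr : Nat.card (FiniteField.Extension K p (k + 1)) = p ^ (a * (k + 1)) := by
    rw [hcard, hK, pow_mul]
  simp only [map_teichEval_frobProd_eq p hr hE]
  rw [expSum, ← hcard, sum_nthRootsFinset, map_sum]

theorem coeff_adicTrace_dworkMatrix (hE : splitSeries p f = swap _ E) {d : ℕ}
    (hd : HasWeight d E) (k : ℕ) {m r : ℕ} (hr : d * m < r) :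
    coeff m (adicTrace (dworkMatrix p f (a * (k + 1)))) = ∑ u ∈ Finset.range r,
      (coeff m (frobProd p E (a * (k + 1)))).coeff ((p ^ (a * (k + 1)) - 1) * u) := by
  have hdecays : Decays d (dworkMatrix p f (a * (k + 1))) :=
    (isPowers_dworkMatrix p hK hE).decays
      (decays_dworkMatrix p hK hE (exponent_ne_zero p hK) hd) k
  rw [hdecays.coeff_adicTrace hr]
  refine Finset.sum_congr rfl fun u _ => ?_
  rw [dworkMatrix_apply p hK hE,
    if_pos (Nat.le_mul_of_pos_left u (pow_pos (Fact.out : p.Prime).pos _)), coeff_coeff_swap,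
    Nat.sub_mul, one_mul]

theorem card_pow_sub_one_mul_adicTrace (hE : IsProdLimit p (polySplitFactor p f) E) {d : ℕ}
    (hd : HasWeight d E) (k : ℕ) :
    ((Nat.card K ^ (k + 1) - 1 : ℕ) : (WittVector p K)⟦X⟧) *
        adicTrace (dworkMatrix p f (a * (k + 1))) =
      PowerSeries.map (padicIntToWitt p) (expSum p f (k + 1)) := by
  let L := FiniteField.Extension K p (k + 1)
  have : Fintype Lˣ := Fintype.ofFinite _
  let ι : WittVector p K →+* WittVector p L := WittVector.map (algebraMap K L)
  have hcard : Nat.card L = Nat.card K ^ (k + 1) := FiniteField.natCard_extension K p (k + 1)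
  have hr : p ^ (a * (k + 1)) = Nat.card L := by rw [hcard, hK, pow_mul]
  have hsplit := hE.splitConverges_and_splitSeries_eq.2
  refine PowerSeries.map_injective ι (WittVector.map_injective _ (algebraMap K L).injective) ?_
  ext m : 1
  let g := coeff m (frobProd p E (a * (k + 1)))
  let r := d * m + 1 + g.natDegree
  calc coeff m (PowerSeries.map ι (((Nat.card K ^ (k + 1) - 1 : ℕ) : (WittVector p K)⟦X⟧) *
        adicTrace (dworkMatrix p f (a * (k + 1)))))
      = ((Nat.card L - 1 : ℕ) : WittVector p L) *
          ∑ u ∈ Finset.range r, ι (g.coeff ((Nat.card L - 1) * u)) := by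
        rw [← hcard, map_mul, map_natCast, ← map_natCast (C (R := WittVector p L)), coeff_C_mul,
          coeff_map, coeff_adicTrace_dworkMatrix p hK hsplit hd k (r := r) (by omega), map_sum, hr]
    _ = ∑ t : Lˣ, teichEval p K (t : L) g := (sum_teichEval_units p (by omega)).symm
    _ = coeff m (PowerSeries.map (padicIntToWitt p) (expSum p f (k + 1))) := by
        rw [map_expSum p hK hE, map_sum]
        simp only [coeff_map, g, L]
    _ = coeff m (PowerSeries.map ι (PowerSeries.map (padicIntToWitt p) (expSum p f (k + 1)))) := by
        rw [coeff_map, coeff_map, coeff_map, map_padicIntToWitt]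

end TraceFormula

section CFunction

theorem isUnit_p_pow_sub_one (p : ℕ) [Fact p.Prime] {m : ℕ} (hm : m ≠ 0) :
    IsUnit ((p ^ m - 1 : ℕ) : ℤ_[p]) := by
  have hunit := IsLocalRing.isUnit_one_sub_self_of_mem_nonunits _
    (mt (isUnit_pow_iff hm).1 (PadicInt.p_nonunit (p := p)))
  rw [Nat.cast_sub (Nat.one_le_pow _ _ (Fact.out : p.Prime).pos), Nat.cast_pow, Nat.cast_one,
    ← neg_sub]
  exact hunit.neg

variable (p : ℕ) [Fact p.Prime] {K : Type*} [Field K] [Finite K]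

theorem isUnit_card_pow_sub_one {a : ℕ} (hK : Nat.card K = p ^ a) (k : ℕ) :
    IsUnit ((Nat.card K ^ (k + 1) - 1 : ℕ) : ℤ_[p]) := by
  rw [hK, ← pow_mul]
  exact isUnit_p_pow_sub_one p (mul_ne_zero (exponent_ne_zero p hK) k.succ_ne_zero)

variable [CharP K p]

/-- The series `S_f(T, k + 1) / (q ^ (k + 1) - 1)` over `ℤ_p`, where `q = #K`: the weights in the
exponent of `C_f(T, s)`. The shift by one leaves out the undefined quotient at `k = 0`. -/
noncomputable def normalizedSum (f : ℕ → Polynomial K) (k : ℕ) : ℤ_[p]⟦X⟧ :=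
  C (Ring.inverse ((Nat.card K ^ (k + 1) - 1 : ℕ) : ℤ_[p])) * expSum p f (k + 1)

variable {a : ℕ} (hK : Nat.card K = p ^ a) (f : ℕ → Polynomial K)

include hK in
theorem card_pow_sub_one_mul_normalizedSum (k : ℕ) :
    ((Nat.card K ^ (k + 1) - 1 : ℕ) : ℤ_[p]⟦X⟧) * normalizedSum p f k = expSum p f (k + 1) := by
  rw [normalizedSum, ← mul_assoc, ← map_natCast (C (R := ℤ_[p])), ← map_mul,
    Ring.mul_inverse_cancel _ (isUnit_card_pow_sub_one p hK k), map_one, one_mul]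

theorem constantCoeff_cExponent : constantCoeff (cExponent p f) = 0 := by
  rw [← coeff_zero_eq_constantCoeff_apply, cExponent, coeff_mk]

include hK in
theorem coeff_derivative_cExponent (k : ℕ) :
    coeff k (derivative _ (cExponent p f)) =
      -PowerSeries.map PadicInt.Coe.ringHom (normalizedSum p f k) := by
  have hcast : (Nat.card K : ℚ_[p]) ^ (k + 1) - 1 = ((Nat.card K ^ (k + 1) - 1 : ℕ) : ℚ_[p]) := by
    rw [Nat.cast_sub (Nat.one_le_pow _ _ Nat.card_pos), Nat.cast_pow, Nat.cast_one]
  have hne : ((Nat.card K ^ (k + 1) - 1 : ℕ) : ℚ_[p]) ≠ 0 :=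
    mod_cast (isUnit_card_pow_sub_one p hK k).ne_zero
  have hcancel : (((k + 1 : ℕ) : ℚ_[p]) * ((Nat.card K ^ (k + 1) - 1 : ℕ) : ℚ_[p]))⁻¹ *
      ((Nat.card K ^ (k + 1) - 1 : ℕ) : ℚ_[p]) * ((k + 1 : ℕ) : ℚ_[p]) = 1 := by
    have hsucc : ((k + 1 : ℕ) : ℚ_[p]) ≠ 0 := Nat.cast_ne_zero.2 k.succ_ne_zero
    field_simp
  have hcancel' := congrArg (C (R := ℚ_[p])) hcancel
  rw [map_mul, map_mul, map_natCast, map_natCast, map_one] at hcancel'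
  simp only [coeff_derivative, cExponent, coeff_mk]
  rw [hcast, ← card_pow_sub_one_mul_normalizedSum p hK f k, map_mul, map_natCast,
    ← Nat.cast_add_one]
  linear_combination -PowerSeries.map PadicInt.Coe.ringHom (normalizedSum p f k) * hcancel'

theorem coeff_zero_cFunction : coeff 0 (cFunction p f) = 1 := by
  have hconst := constantCoeff_cExponent p f
  rw [cFunction, subst_eq_C_add_mul _ (HasSubst.of_constantCoeff_zero' hconst),
    coeff_zero_eq_constantCoeff_apply, map_add, map_mul, hconst, zero_mul, add_zero,
    constantCoeff_C, constantCoeff_exp]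

theorem derivative_cFunction :
    derivative _ (cFunction p f) = derivative _ (cExponent p f) * cFunction p f := by
  rw [cFunction, derivative_subst (HasSubst.of_constantCoeff_zero' (constantCoeff_cExponent p f)),
    derivative_exp, mul_comm]

include hK in
theorem coeff_cFunction_succ_mul (n : ℕ) :
    coeff (n + 1) (cFunction p f) * (n + 1) =
      -∑ i ∈ Finset.range (n + 1), PowerSeries.map PadicInt.Coe.ringHom (normalizedSum p f i) *
        coeff (n - i) (cFunction p f) := by
  rw [← coeff_derivative, derivative_cFunction, coeff_mul,
    Finset.Nat.sum_antidiagonal_eq_sum_range_succ_mk, ← Finset.sum_neg_distrib]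
  exact Finset.sum_congr rfl fun i _ => by rw [coeff_derivative_cExponent p hK, neg_mul]

end CFunction

section AnalyticTraceFormula

theorem natCast_dvd_iff_forall_dvd_coeff {R : Type*} [CommRing R] {n : ℕ} {F : R⟦X⟧} :
    (n : R⟦X⟧) ∣ F ↔ ∀ m, (n : R) ∣ coeff m F := by
  rw [← map_natCast (C (R := R))]
  refine ⟨fun ⟨G, hG⟩ m => ⟨coeff m G, by rw [hG, coeff_C_mul]⟩, fun h => ?_⟩
  choose g hg using h
  exact ⟨PowerSeries.mk g, by ext m; rw [coeff_C_mul, coeff_mk, hg]⟩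

/- By `hφ` the division by `n + 1` in Newton's recursion can be carried out in `A` itself. -/
theorem exists_map_eq_of_newton {A B B' : Type*} [CommRing A] [CommRing B] [IsDomain B]
    [CharZero B] [CommRing B'] [IsDomain B'] [CharZero B'] (φ : A →+* B) (φ' : A →+* B')
    (hφ : ∀ (n : ℕ) (z : A), (n : B) ∣ φ z → (n : A) ∣ z) {t : ℕ → A} {b : ℕ → B} {b' : ℕ → B'}
    (hb_zero : b 0 = 1) (hb'_zero : b' 0 = 1)
    (hb : ∀ n : ℕ, b (n + 1) * (n + 1) = -∑ i ∈ Finset.range (n + 1), φ (t i) * b (n - i))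
    (hb' : ∀ n : ℕ, b' (n + 1) * (n + 1) = -∑ i ∈ Finset.range (n + 1), φ' (t i) * b' (n - i))
    (n : ℕ) : ∃ c : A, φ c = b n ∧ φ' c = b' n := by
  induction n using Nat.strong_induction_on with
  | _ n ih =>
    cases n with
    | zero => exact ⟨1, by rw [map_one, hb_zero], by rw [map_one, hb'_zero]⟩
    | succ n =>
      choose c hc hc' using fun i => ih (n - i) (by omega)
      let z : A := -∑ i ∈ Finset.range (n + 1), t i * c i
      have hz : φ z = b (n + 1) * (n + 1 : ℕ) := by
        simp only [z, Nat.cast_add_one, hb, map_neg, map_sum, map_mul, hc]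
      have hz' : φ' z = b' (n + 1) * (n + 1 : ℕ) := by
        simp only [z, Nat.cast_add_one, hb', map_neg, map_sum, map_mul, hc']
      obtain ⟨e, he⟩ := hφ (n + 1) z (hz ▸ dvd_mul_left _ _)
      rw [he, map_mul, map_natCast, mul_comm] at hz hz'
      exact ⟨e, mul_right_cancel₀ (Nat.cast_ne_zero.2 n.succ_ne_zero) hz,
        mul_right_cancel₀ (Nat.cast_ne_zero.2 n.succ_ne_zero) hz'⟩

variable (p : ℕ) [Fact p.Prime] {K : Type*} [Field K] [CharP K p]

theorem natCast_dvd_of_dvd_map_padicIntToWitt {n : ℕ} {z : ℤ_[p]⟦X⟧}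
    (h : (n : (WittVector p K)⟦X⟧) ∣ PowerSeries.map (padicIntToWitt p) z) :
    (n : ℤ_[p]⟦X⟧) ∣ z := by
  have := isLocalHom_padicIntToWitt p (L := K)
  rw [natCast_dvd_iff_forall_dvd_coeff] at h ⊢
  refine fun m => dvd_of_map_dvd (padicIntToWitt_injective p (L := K)) ?_
  rw [map_natCast, ← coeff_map]
  exact h m

variable [Finite K] {a : ℕ} (hK : Nat.card K = p ^ a) {f : ℕ → Polynomial K}
  {E : (Polynomial (WittVector p K))⟦X⟧} (hE : IsProdLimit p (polySplitFactor p f) E) {d : ℕ}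
  (hd : HasWeight d E)

include hK hE hd

theorem adicTrace_dworkMatrix_eq_map_normalizedSum (k : ℕ) :
    adicTrace (dworkMatrix p f (a * (k + 1))) =
      PowerSeries.map (padicIntToWitt p) (normalizedSum p f k) := by
  have hunit : IsUnit ((Nat.card K ^ (k + 1) - 1 : ℕ) : (WittVector p K)⟦X⟧) := by
    have := (isUnit_card_pow_sub_one p hK k).map ((C (R := WittVector p K)).comp (padicIntToWitt p))
    rwa [map_natCast] at this
  refine hunit.mul_left_cancel ?_
  rw [card_pow_sub_one_mul_adicTrace p hK hE hd, ← card_pow_sub_one_mul_normalizedSum p hK f k,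
    map_mul, map_natCast]

theorem exists_integral_cFunction :
    ∃ D : ℤ_[p]⟦X⟧⟦X⟧,
      PowerSeries.map (PowerSeries.map PadicInt.Coe.ringHom) D = cFunction p f ∧
      PowerSeries.map (PowerSeries.map (padicIntToWitt p)) D =
        fredholmDet (dworkMatrix p f a) := by
  have := charZero_wittVector p K
  have : CharZero (WittVector p K)⟦X⟧ := charZero_of_injective_ringHom C_injective
  have : CharZero ℚ_[p]⟦X⟧ := charZero_of_injective_ringHom C_injective
  have hsplit := hE.splitConverges_and_splitSeries_eq.2
  have hA := decays_dworkMatrix p hK hsplit (exponent_ne_zero p hK) hd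
  have hnewton : ∀ n : ℕ, coeff (n + 1) (fredholmDet (dworkMatrix p f a)) * (n + 1) =
      -∑ i ∈ Finset.range (n + 1), PowerSeries.map (padicIntToWitt p) (normalizedSum p f i) *
        coeff (n - i) (fredholmDet (dworkMatrix p f a)) := by
    simpa only [adicTrace_dworkMatrix_eq_map_normalizedSum p hK hE hd] using
      (isPowers_dworkMatrix p hK hsplit).coeff_fredholmDet_succ_mul hA
  choose D hdet hC using exists_map_eq_of_newton
    (PowerSeries.map (padicIntToWitt p)) (PowerSeries.map PadicInt.Coe.ringHom)
    (fun _ _ => natCast_dvd_of_dvd_map_padicIntToWitt p)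
    (b := fun n => coeff n (fredholmDet (dworkMatrix p f a)))
    (b' := fun n => coeff n (cFunction p f))
    hA.coeff_zero_fredholmDet (coeff_zero_cFunction p f) hnewton (coeff_cFunction_succ_mul p hK f)
  refine ⟨PowerSeries.mk D, ?_, ?_⟩ <;> ext n : 1
  · rw [coeff_map, coeff_mk, hC]
  · rw [coeff_map, coeff_mk, hdet]

end AnalyticTraceFormula

end TAdicWitt

theorem theorem4 (p : ℕ) [Fact p.Prime] (a : ℕ) {K : Type*} [Field K] [Finite K] [CharP K p]
    (hK : Nat.card K = p ^ a) (f : ℕ → Polynomial K) (hf₀ : 0 < (f 0).natDegree)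
    (hf : BddAbove (Set.range fun i => (f i).natDegree)) :
    TAdicWitt.SplitConverges p f ∧
    TAdicWitt.HasFredholmDet (TAdicWitt.dworkMatrix p f a) ∧
    ∃ D : PowerSeries (PowerSeries ℤ_[p]),
      PowerSeries.map (PowerSeries.map PadicInt.Coe.ringHom) D = TAdicWitt.cFunction p f ∧
      PowerSeries.map (PowerSeries.map (TAdicWitt.padicIntToWitt p)) D =
        TAdicWitt.fredholmDet (TAdicWitt.dworkMatrix p f a) ∧
      TAdicWitt.IsTAdicEntire D := by
  obtain ⟨d, hd⟩ := hf
  obtain ⟨E, hweight, hE⟩ :=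
    TAdicWitt.exists_isProdLimit_polySplitFactor p f fun i => hd (Set.mem_range_self i)
  obtain ⟨hconv, hsplit⟩ := hE.splitConverges_and_splitSeries_eq
  have hA := TAdicWitt.decays_dworkMatrix p hK hsplit (TAdicWitt.exponent_ne_zero p hK) hweight
  obtain ⟨D, hC, hdet⟩ := TAdicWitt.exists_integral_cFunction p hK hE hweight
  have hentire : TAdicWitt.IsTAdicEntire D :=
    TAdicWitt.isTAdicEntire_of_map (TAdicWitt.padicIntToWitt_injective p)
      (hdet ▸ hA.isTAdicEntire_fredholmDet)
  exact ⟨hconv, hA.hasFredholmDet, D, hC, hdet, hentire⟩
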